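/- Let $m,n\ge 0$ be integers, $\overline\varrho\ge 1$, $\sigma\ge 0$, $\varkappa\ge0$, $0<\alpha\le 1$. Write $\|u\|_{n,2}=(\sum_{t=0}^n|u_t|^2)^{1/2}$ for $u\in\mathbb C^{\mathbb Z}$, $[\Delta u]_t=u_{t-1}$, $[u*v]_t=\sum_{\tau\in\mathbb Z}u_\tau v_{t-\tau}$, and let $\|u\|^*_{m,1}=\sum_{k=0}^{m}\big|(m+1)^{-1/2}\sum_{t=0}^m u_t e^{2\pi i kt/(m+1)}\big|$ be the $\ell_1$-norm of the unitary discrete Fourier transform of $(u_0,\dots,u_m)$. Let $y_t=x_t+\sigma\zeta_t$, where $\zeta_t$, $-m\le t\le n$, are independent, $\zeta_t=\xi_t^1+i\xi_t^2$ with independent $\xi_t^1,\xi_t^2\sim\mathcal N(0,1)$. Suppose that the signal $x\in\mathbb C^{\mathbb Z}$ is close to a shift-invariant subspace: $x=x^{\mathcal S}+\varepsilon$, where $x^{\mathcal S}\in\mathcal S$ for an (unknown) complex linear subspace $\mathcal S\subset\mathbb C^{\mathbb Z}$ with $\Delta\mathcal S\subseteq\mathcal S$ and $\dim\mathcal S=s$,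 $1\le s\le n+1$, and $\|\Delta^\tau\varepsilon\|_{n,2}\le\sigma\varkappa$ for $0\le\tau\le m$. Call $\varphi\in\mathbb C^{\mathbb Z}$ feasible if $\varphi_t=0$ for $t\notin[0,m]$ and $\|\varphi\|^*_{m,1}\le\overline\varrho/\sqrt{m+1}$. Put $$\kappa_{m,n}=\sqrt{\tfrac{n+1}{m+1}},\qquad c_\alpha=\sqrt{2\ln[16/\alpha]},\qquad V_\alpha=2(1+4\kappa_{m,n})^2\ln[55(m+n+1)/\alpha].$$ Then there is an absolute constant $C>0$ such that, for every feasible $\varphi$, there is a set $\Xi_\alpha$ of realizations of the noise with $\mathbb P\{\zeta\in\Xi_\alpha\}\ge1-\alpha$ for which, whenever $\zeta\in\Xi_\alpha$, every minimizer $\widehat\varphi$ of $\|y-\psi*y\|_{n,2}^2$ over all feasible $\psi$ satisfies the following. (i) $$\|x-\widehat\varphi*y\|_{n,2}\le\|x-\varphi*y\|_{n,2}+2\sigma\Big[\sqrt{\overline\varrho V_\alpha}+\sqrt{(\overline\varrho+1)c_\alpha\varkappa}+\sqrt{2s}+c_\alpha\Big].$$ (ii) If $m,n\ge1$, then $\|x-\widehat\varphi*y\|_{n,2}\le\|x-\varphi*y\|_{n,2}+C\sigma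 \tilde r_0^{1/2}$ with $$\tilde r_0=\overline\varrho(1+\kappa_{m,n}^2)\ln[(m+n)/\alpha]+\overline\varrho\varkappa\sqrt{\ln[2/\alpha]}+s.$$ (iii) If $1\le m\le n$ and $\alpha\le 1/2$, then $\|x-\widehat\varphi*y\|_{n,2}\le\|x-\varphi*y\|_{n,2}+C\sigma r_0^{1/2}$ with $$r_0=\overline\varrho\kappa_{m,n}^2\ln[(m+n)/\alpha]+\overline\varrho\varkappa\sqrt{\ln[1/\alpha]}+s.$$ -/

import Mathlib

open MeasureTheory ProbabilityTheory

noncomputable section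

namespace FilterLS

/-- The right shift `[Δ x]_t = x_{t-1}` on two-sided complex sequences. -/
def shift : (ℤ → ℂ) →ₗ[ℂ] (ℤ → ℂ) where
  toFun x := fun t => x (t - 1)
  map_add' _ _ := rfl
  map_smul' _ _ := rfl

/-- The convolution `[u * v]_t = ∑_τ u_τ v_{t-τ}` (it is used for finitely supported `u`). -/
def conv (u v : ℤ → ℂ) : ℤ → ℂ := fun t => ∑' τ : ℤ, u τ * v (t - τ)

/-- The Euclidean norm of the restriction of `x` to `[0, n]`. -/
def l2norm (n : ℕ) (x : ℤ → ℂ) : ℝ :=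
  Real.sqrt (∑ t ∈ Finset.range (n + 1), ‖x (t : ℤ)‖ ^ 2)

/-- The `k`-th coefficient of the unitary discrete Fourier transform of `(x_0, …, x_n)`. -/
def dft (n : ℕ) (x : ℤ → ℂ) (k : ℕ) : ℂ :=
  ((Real.sqrt ((n : ℝ) + 1))⁻¹ : ℝ) * ∑ t ∈ Finset.range (n + 1),
    x (t : ℤ) * Complex.exp (2 * Real.pi * Complex.I * k * t / ((n : ℂ) + 1))

/-- The `ℓ₁`-norm of the unitary discrete Fourier transform of `(x_0, …, x_n)`. -/
def fourierL1 (n : ℕ) (x : ℤ → ℂ) : ℝ :=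
  ∑ k ∈ Finset.range (n + 1), ‖dft n x k‖

/-- The filters supported on `[0, m]` whose Fourier `ℓ₁`-norm is at most `ρ / √(m+1)`. -/
def feasible (m : ℕ) (ρ : ℝ) : Set (ℤ → ℂ) :=
  {φ | (∀ t : ℤ, t ∉ Set.Icc (0 : ℤ) m → φ t = 0) ∧
    fourierL1 m φ ≤ ρ / Real.sqrt ((m : ℝ) + 1)}

/-- `φ` is an optimal solution of the constrained least-squares problem
`min {‖y - φ * y‖²_{n,2} : φ ∈ feasible m ρ}`. -/
def IsConstrainedLS (m n : ℕ) (ρ : ℝ) (y φ : ℤ → ℂ) : Prop :=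
  φ ∈ feasible m ρ ∧ ∀ ψ ∈ feasible m ρ, l2norm n (y - conv φ y) ^ 2 ≤ l2norm n (y - conv ψ y) ^ 2

/-- The signal `x` is `ℓ₂`-close, at level `σ ϰ`, to a shift-invariant subspace of
dimension `s`, where `1 ≤ s ≤ n + 1`. -/
def NearShiftInvariant (m n s : ℕ) (σ ϰ : ℝ) (x : ℤ → ℂ) : Prop :=
  1 ≤ s ∧ s ≤ n + 1 ∧
    ∃ S : Submodule ℂ (ℤ → ℂ), Module.finrank ℂ S = s ∧ (∀ u ∈ S, shift u ∈ S) ∧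
      ∃ xS ∈ S, ∃ ε : ℤ → ℂ, x = xS + ε ∧
        ∀ τ : ℕ, τ ≤ m → l2norm n ((shift ^ τ) ε) ≤ σ * ϰ

/-- The variables `ζ_t`, `t ∈ I`, are independent, and each is `ξ₁ + i ξ₂` with independent
standard real Gaussian `ξ₁`, `ξ₂`. -/
structure IsComplexWhiteNoise {Ω : Type*} [MeasurableSpace Ω] (μ : Measure Ω) (I : Set ℤ)
    (ζ : ℤ → Ω → ℂ) : Prop where
  measurable : ∀ t ∈ I, Measurable (ζ t)
  law : ∀ t ∈ I, μ.map (fun ω => ((ζ t ω).re, (ζ t ω).im)) =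
    (gaussianReal 0 1).prod (gaussianReal 0 1)
  indep : iIndepFun (fun (t : I) => ζ t) μ

/-- The observations `y_t = x_t + σ z_t`. -/
def observe (x : ℤ → ℂ) (σ : ℝ) (z : ℤ → ℂ) : ℤ → ℂ := fun t => x t + σ * z t

/-- `κ_{m,n} = √((n+1)/(m+1))`. -/
def kappa (m n : ℕ) : ℝ := Real.sqrt (((n : ℝ) + 1) / ((m : ℝ) + 1))

/-- `c_α = √(2 ln(16/α))`. -/
def cAlpha (α : ℝ) : ℝ := Real.sqrt (2 * Real.log (16 / α))

/-- `V_α = 2 (1 + 4 κ)² ln(55 (m+n+1)/α)`. -/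
def vAlpha (m n : ℕ) (α : ℝ) : ℝ :=
  2 * (1 + 4 * kappa m n) ^ 2 * Real.log (55 * ((m : ℝ) + n + 1) / α)

/-- The remainder `ρ κ² ln((m+n)/α) + ρ ϰ √(ln(1/α)) + s`. -/
def r0 (m n s : ℕ) (ρ ϰ α : ℝ) : ℝ :=
  ρ * kappa m n ^ 2 * Real.log (((m : ℝ) + n) / α) + ρ * ϰ * Real.sqrt (Real.log (1 / α)) + s

/-- The remainder `ρ (1 + κ²) ln((m+n)/α) + ρ ϰ √(ln(2/α)) + s`. -/
def r0Uniform (m n s : ℕ) (ρ ϰ α : ℝ) : ℝ :=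
  ρ * (1 + kappa m n ^ 2) * Real.log (((m : ℝ) + n) / α)
    + ρ * ϰ * Real.sqrt (Real.log (2 / α)) + s

end FilterLS

end

/-! Put `y = x + σζ` and let `W` be the restriction of the invariant subspace `S` to `[0, n]`.
Comparing the minimizer `φhat` with `φ` and expanding the squares gives ‖x - φhat*y‖² ≤ ‖x - φ*y‖² +
2σ Re⟨ζ, (x - φ*y) - (x - φhat*y)⟩, with norms and inner products on `[0, n]`.

The noise is split along `W` and `Wᗮ`. The `W` part contributes at most ‖P_W ζ‖ times a residual
norm, and ‖P_W ζ‖ ≤ √(2s) + c_α with high probability. Against the `Wᗮ` part, xS - ψ*xS disappears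
because `S` is shift-invariant; what remains of x - ψ*y is ε - ψ*ε - σ ψ*ζ. The term ε does not
depend on ψ and cancels in the difference. The other two are linear in ψ, and a feasible filter is a
combination of `m + 1` Fourier modes whose coefficients have ℓ₁-norm at most ρ
(`exists_coeff_of_mem_feasible`). Uniform control over all feasible filters, hence over the random
`φhat`, thus reduces to `m + 1` quadratic forms and `m + 1` linear functionals of ζ.

The quadratic forms are treated by a Laurent-Massart bound (`quadraticForm_tail`,
`norm_inner_apply_tail`), which needs a Hilbert-Schmidt norm and a trace. The Hilbert-Schmidt norm
of a windowed mode is at most κ. For the trace, the windowed convolution is cut out of a circulant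
operator of order `m + n + 1`, so it is a sum of rank-one operators weighted by its transfer
function (`norm_trace_windowConv_le`); for a mode this function is a Dirichlet kernel, whose sum
over a regular grid costs only a logarithm (`sum_norm_dirichlet_le`). For the linear functionals,
Parseval bounds the total energy over the modes, so the union bound loses no logarithm of `m`
(`exists_norm_inner_tail`).

On the resulting event `noiseEvent`, a quadratic inequality for ‖x - φhat*y‖ is solved
(`le_of_sq_le_add`); the forms with an absolute constant follow by elementary estimates. -/

noncomputable section

namespace FilterLS

open scoped ENNReal

/-! ### Law, tail and exponential moments of one complex Gaussian variable. -/

section ComplexGaussian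

/-- Integral of a radial Gaussian function over the complement of a disc. -/
lemma setLIntegral_exp_neg_mul_sq_norm {b t : ℝ} (hb : 0 < b) (ht : 0 ≤ t) :
    ∫⁻ z in {z : ℂ | t ≤ ‖z‖ ^ 2}, ENNReal.ofReal (Real.exp (-b * ‖z‖ ^ 2))
      = ENNReal.ofReal (Real.pi / b * Real.exp (-b * t)) := by
  have hms : MeasurableSet {z : ℂ | t ≤ ‖z‖ ^ 2} :=
    measurableSet_le measurable_const (by fun_prop)
  rw [← lintegral_indicator hms, ← Complex.lintegral_comp_polarCoord_symm, polarCoord_target]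
  set F : ℝ → ℝ≥0∞ := (Set.Ici (Real.sqrt t)).indicator
    (fun r => ENNReal.ofReal (r * Real.exp (-b * r ^ 2))) with hF
  have hFm : Measurable F := Measurable.indicator (by fun_prop) measurableSet_Ici
  have h1 : ∀ p ∈ Set.Ioi (0 : ℝ) ×ˢ Set.Ioo (-Real.pi) Real.pi,
      ENNReal.ofReal p.1 • ({z : ℂ | t ≤ ‖z‖ ^ 2}.indicator
        (fun z => ENNReal.ofReal (Real.exp (-b * ‖z‖ ^ 2))) (Complex.polarCoord.symm p))
      = F p.1 * (fun _ : ℝ => 1) p.2 := by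
    rintro ⟨r, θ⟩ ⟨hr, -⟩
    have hr' : (0 : ℝ) < r := hr
    simp only [hF, Set.indicator, Set.mem_ofPred_eq, Complex.norm_polarCoord_symm, sq_abs,
      Set.mem_Ici, Real.sqrt_le_left hr'.le, smul_eq_mul, mul_one]
    split_ifs
    · rw [← ENNReal.ofReal_mul hr'.le]
    · simp
  rw [setLIntegral_congr_fun (measurableSet_Ioi.prod measurableSet_Ioo) h1]
  rw [Measure.volume_eq_prod, ← Measure.prod_restrict, lintegral_prod_mul (f := F) (g := fun _ => 1)
      hFm.aemeasurable aemeasurable_const]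
  · rw [hF, lintegral_one, Measure.restrict_apply_univ, Real.volume_Ioo,
      lintegral_indicator measurableSet_Ici, Measure.restrict_restrict measurableSet_Ici]
    have h2 : ∫⁻ r in Set.Ici (Real.sqrt t) ∩ Set.Ioi 0,
        ENNReal.ofReal (r * Real.exp (-b * r ^ 2))
        = ∫⁻ r in Set.Ioi (Real.sqrt t), ENNReal.ofReal (r * Real.exp (-b * r ^ 2)) := by
      apply setLIntegral_congr
      have h0 := ae_eq_set_inter (Ioi_ae_eq_Ici (a := Real.sqrt t) (μ := volume)).symm
        (ae_eq_refl (Set.Ioi (0 : ℝ)))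
      rwa [Set.Ioi_inter_Ioi, sup_of_le_left (Real.sqrt_nonneg t)] at h0
    rw [h2]
    have hderiv : ∀ x ∈ Set.Ici (Real.sqrt t),
        HasDerivAt (fun r => -(1 / (2 * b)) * Real.exp (-b * r ^ 2))
          (x * Real.exp (-b * x ^ 2)) x := by
      intro x _
      have := (((hasDerivAt_pow 2 x).const_mul (-b)).exp).const_mul (-(1 / (2 * b)))
      refine this.congr_deriv ?_
      push_cast
      field_simp
    have hlim : Filter.Tendsto (fun r : ℝ => -(1 / (2 * b)) * Real.exp (-b * r ^ 2))
        Filter.atTop (nhds 0) := by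
      have : Filter.Tendsto (fun r : ℝ => -b * r ^ 2) Filter.atTop Filter.atBot :=
        (Filter.tendsto_pow_atTop two_ne_zero).const_mul_atTop_of_neg (by linarith)
      simpa using (Real.tendsto_exp_atBot.comp this).const_mul (-(1 / (2 * b)))
    have hpos : ∀ x ∈ Set.Ioi (Real.sqrt t), 0 ≤ x * Real.exp (-b * x ^ 2) := fun x hx =>
      mul_nonneg ((Real.sqrt_nonneg t).trans (le_of_lt hx)) (Real.exp_nonneg _)
    have hint := integrableOn_Ioi_deriv_of_nonneg' hderiv hpos hlim
    rw [← ofReal_integral_eq_lintegral_ofReal hint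
      ((ae_restrict_iff' measurableSet_Ioi).2 (Filter.Eventually.of_forall hpos)),
      integral_Ioi_of_hasDerivAt_of_nonneg' hderiv hpos hlim,
      ← ENNReal.ofReal_mul']
    · congr 1
      rw [Real.sq_sqrt ht]
      field_simp
      ring
    · linarith [Real.pi_pos]

/-- The law of `ξ₁ + i ξ₂`, with independent standard Gaussian `ξ₁` and `ξ₂`. -/
lemma map_prod_gaussianReal_eq_stdGaussian :
    ((gaussianReal 0 1).prod (gaussianReal 0 1)).map
      (fun p : ℝ × ℝ => Complex.measurableEquivRealProd.symm p) = stdGaussian ℂ := by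
  rw [stdGaussian_eq_map_pi_orthonormalBasis Complex.orthonormalBasisOneI,
    ← (measurePreserving_finTwoArrow (gaussianReal 0 1)).map_eq,
    Measure.map_map (by fun_prop) (by fun_prop)]
  congr 1
  funext x
  apply Complex.ext <;> simp [Fin.sum_univ_two, MeasurableEquiv.finTwoArrow]

lemma stdGaussian_complex_eq_withDensity :
    stdGaussian ℂ = (volume : Measure ℂ).withDensity
      (fun z => ENNReal.ofReal ((2 * Real.pi)⁻¹ * Real.exp (-(1 / 2) * ‖z‖ ^ 2))) := by
  rw [← map_prod_gaussianReal_eq_stdGaussian, gaussianReal_of_var_ne_zero _ one_ne_zero,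
    prod_withDensity (by fun_prop) (by fun_prop), ← Measure.volume_eq_prod,
    ← Complex.volume_preserving_equiv_real_prod.symm.map_eq]
  ext s hs
  rw [Measure.map_apply (by fun_prop) hs, withDensity_apply _ hs,
    withDensity_apply _ (Complex.measurableEquivRealProd.symm.measurable hs),
    Measure.restrict_map Complex.measurableEquivRealProd.symm.measurable hs,
    lintegral_map (by fun_prop) Complex.measurableEquivRealProd.symm.measurable]
  refine lintegral_congr fun p => ?_
  rw [gaussianPDF, gaussianPDF, ← ENNReal.ofReal_mul (gaussianPDFReal_nonneg _ _ _)]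
  congr 1
  simp only [gaussianPDFReal, NNReal.coe_one, mul_one, sub_zero]
  rw [mul_mul_mul_comm, ← Real.exp_add, ← mul_inv, Real.mul_self_sqrt (by positivity),
    Complex.sq_norm, Complex.normSq_apply]
  congr 2
  simp only [Complex.measurableEquivRealProd_symm_apply]
  ring

/-- The tail of the squared modulus of a standard complex Gaussian variable. -/
lemma stdGaussian_complex_tail {t : ℝ} (ht : 0 ≤ t) :
    stdGaussian ℂ {z | 2 * t ≤ ‖z‖ ^ 2} = ENNReal.ofReal (Real.exp (-t)) := by
  have hms : MeasurableSet {z : ℂ | 2 * t ≤ ‖z‖ ^ 2} :=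
    measurableSet_le measurable_const (by fun_prop)
  rw [stdGaussian_complex_eq_withDensity, withDensity_apply _ hms]
  simp_rw [ENNReal.ofReal_mul (show (0 : ℝ) ≤ (2 * Real.pi)⁻¹ by positivity)]
  rw [lintegral_const_mul _ (by fun_prop),
    setLIntegral_exp_neg_mul_sq_norm (by norm_num) (by positivity),
    ← ENNReal.ofReal_mul (by positivity)]
  congr 1
  have := Real.pi_pos
  field_simp

/-- The moment generating function of the squared modulus of a standard complex Gaussian
variable. -/
lemma lintegral_exp_mul_sq_norm_stdGaussian {x : ℝ} (hx : x < 1) :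
    ∫⁻ z, ENNReal.ofReal (Real.exp (x * (‖z‖ ^ 2 / 2))) ∂(stdGaussian ℂ)
      = ENNReal.ofReal (1 - x)⁻¹ := by
  rw [stdGaussian_complex_eq_withDensity, lintegral_withDensity_eq_lintegral_mul _ (by fun_prop)
    (by fun_prop)]
  have h : ∀ z : ℂ,
      ((fun z : ℂ => ENNReal.ofReal ((2 * Real.pi)⁻¹ * Real.exp (-(1 / 2) * ‖z‖ ^ 2)))
      * fun z : ℂ => ENNReal.ofReal (Real.exp (x * (‖z‖ ^ 2 / 2)))) z
      = ENNReal.ofReal (2 * Real.pi)⁻¹ *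
        ENNReal.ofReal (Real.exp (-((1 - x) / 2) * ‖z‖ ^ 2)) := by
    intro z
    rw [Pi.mul_apply, ENNReal.ofReal_mul (by positivity), mul_assoc,
      ← ENNReal.ofReal_mul (by positivity), ← Real.exp_add]
    congr 3
    ring
  simp_rw [h]
  rw [lintegral_const_mul _ (by fun_prop)]
  have := setLIntegral_exp_neg_mul_sq_norm (b := (1 - x) / 2) (t := 0) (by linarith) le_rfl
  rw [show {z : ℂ | (0 : ℝ) ≤ ‖z‖ ^ 2} = Set.univ from
    Set.eq_univ_of_forall fun z => sq_nonneg ‖z‖, Measure.restrict_univ] at this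
  rw [this, ← ENNReal.ofReal_mul (by positivity)]
  congr 1
  have h1 : 1 - x ≠ 0 := by linarith
  have := Real.pi_pos
  rw [mul_zero, Real.exp_zero]
  field_simp

/-- The coordinates of a standard Gaussian vector of `ℂ^ι` are independent. -/
lemma map_pi_stdGaussian_complex {ι : Type*} [Fintype ι] :
    (Measure.pi (fun _ : ι => stdGaussian ℂ)).map (WithLp.toLp 2)
      = stdGaussian (EuclideanSpace ℂ ι) := by
  apply Measure.ext_of_charFun (E := EuclideanSpace ℂ ι)
  ext t
  simp_rw [charFun_stdGaussian, charFun_pi, charFun_stdGaussian, ← Complex.exp_sum,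
    ← Complex.ofReal_pow, EuclideanSpace.norm_sq_eq]
  simp [Finset.sum_div, neg_div]

end ComplexGaussian

/-! ### Chernoff bounds for Hermitian quadratic forms of a Gaussian vector. -/

section QuadraticForm

/-- This is `1 + u ≤ exp u` at u = x/(1-x). It holds for negative `x` too, so eigenvalues of both
signs can be treated alike. -/
lemma inv_one_sub_le_exp {x : ℝ} (hx : x < 1) : (1 - x)⁻¹ ≤ Real.exp (x + x ^ 2 / (1 - x)) := by
  have h : 0 < 1 - x := by linarith
  have h1 : (1 - x)⁻¹ = (x + x ^ 2 / (1 - x)) + 1 := by field_simp; ring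
  rw [h1]
  exact Real.add_one_le_exp _

lemma lintegral_pi_prod {κ : Type*} [Fintype κ] {X : κ → Type*} [∀ i, MeasurableSpace (X i)]
    {μ : ∀ i, Measure (X i)} [∀ i, IsProbabilityMeasure (μ i)] {f : ∀ i, X i → ℝ≥0∞}
    (hf : ∀ i, Measurable (f i)) :
    ∫⁻ w, ∏ i, f i (w i) ∂(Measure.pi μ) = ∏ i, ∫⁻ z, f i z ∂(μ i) := by
  refine (lintegral_prod_eq_prod_lintegral_of_indepFun Finset.univ
    (fun i (w : ∀ i, X i) => f i (w i)) (iIndepFun_pi fun i => (hf i).aemeasurable)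
    (fun i => by fun_prop)).trans ?_
  exact Finset.prod_congr rfl fun i _ => (measurePreserving_eval μ i).lintegral_comp (hf i)

/-- A Laurent-Massart inequality for weighted sums of squared moduli of independent standard
complex Gaussian variables. -/
lemma weighted_sum_tail {κ : Type*} [Fintype κ] (h : κ → ℝ) {v a t : ℝ} (hv : 0 < v) (ha : 0 ≤ a)
    (ht : 0 ≤ t) (hsq : ∑ i, h i ^ 2 ≤ v) (hmax : ∀ i, h i ≤ a) :
    Measure.pi (fun _ : κ => stdGaussian ℂ)
      {w | 2 * ∑ i, h i + 4 * Real.sqrt (v * t) + 2 * a * t ≤ ∑ i, h i * ‖w i‖ ^ 2}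
      ≤ ENNReal.ofReal (Real.exp (-t)) := by
  obtain ⟨p, hp, rfl⟩ : ∃ p : ℝ, 0 < p ∧ v = p ^ 2 :=
    ⟨Real.sqrt v, Real.sqrt_pos.2 hv, (Real.sq_sqrt hv.le).symm⟩
  obtain ⟨q, hq, rfl⟩ : ∃ q : ℝ, 0 ≤ q ∧ t = q ^ 2 :=
    ⟨Real.sqrt t, Real.sqrt_nonneg t, (Real.sq_sqrt ht).symm⟩
  rw [← mul_pow, Real.sqrt_sq (by positivity)]
  have hpq : 0 < p + a * q := by positivity
  -- Chernoff parameter: with p = √v and q = √t, this choice makes the final exponent exactly -q².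
  set l : ℝ := q / (p + a * q) with hl
  have hl0 : 0 ≤ l := by positivity
  have hla : 1 - l * a = p / (p + a * q) := by rw [hl]; field_simp; ring
  have hla0 : 0 < 1 - l * a := by rw [hla]; positivity
  have hlh : ∀ i, l * h i ≤ l * a := fun i => mul_le_mul_of_nonneg_left (hmax i) hl0
  -- Half the threshold, since each ‖w i‖²/2 is a standard exponential variable.
  set B : ℝ := ∑ i, h i + 2 * (p * q) + a * q ^ 2 with hB
  have hsub : {w : κ → ℂ | 2 * ∑ i, h i + 4 * (p * q) + 2 * a * q ^ 2 ≤ ∑ i, h i * ‖w i‖ ^ 2}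
      ⊆ {w | ENNReal.ofReal (Real.exp (l * B)) ≤
          ∏ i, ENNReal.ofReal (Real.exp (l * h i * (‖w i‖ ^ 2 / 2)))} := by
    intro w hw
    simp only [Set.mem_ofPred_eq] at hw ⊢
    rw [← ENNReal.ofReal_prod_of_nonneg (fun i _ => (Real.exp_nonneg _)), ← Real.exp_sum]
    refine ENNReal.ofReal_le_ofReal (Real.exp_le_exp.2 ?_)
    have : ∑ i, l * h i * (‖w i‖ ^ 2 / 2) = l * ((∑ i, h i * ‖w i‖ ^ 2) / 2) := by
      rw [Finset.sum_div, Finset.mul_sum]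
      exact Finset.sum_congr rfl fun i _ => by ring
    rw [this]
    refine mul_le_mul_of_nonneg_left ?_ hl0
    rw [hB]
    linarith
  refine (measure_mono hsub).trans ?_
  have hmarkov := mul_meas_ge_le_lintegral (μ := Measure.pi (fun _ : κ => stdGaussian ℂ))
    (f := fun w : κ → ℂ => ∏ i, ENNReal.ofReal (Real.exp (l * h i * (‖w i‖ ^ 2 / 2))))
    (by fun_prop) (ENNReal.ofReal (Real.exp (l * B)))
  have hprod : ∫⁻ w, ∏ i, ENNReal.ofReal (Real.exp (l * h i * (‖w i‖ ^ 2 / 2)))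
      ∂(Measure.pi (fun _ : κ => stdGaussian ℂ))
      ≤ ENNReal.ofReal (Real.exp (l * B - q ^ 2)) := by
    rw [lintegral_pi_prod
      (f := fun i (z : ℂ) => ENNReal.ofReal (Real.exp (l * h i * (‖z‖ ^ 2 / 2))))
      (fun i => by fun_prop)]
    have h1 : ∀ i, ∫⁻ z, ENNReal.ofReal (Real.exp (l * h i * (‖z‖ ^ 2 / 2))) ∂(stdGaussian ℂ)
        = ENNReal.ofReal (1 - l * h i)⁻¹ := fun i =>
      lintegral_exp_mul_sq_norm_stdGaussian (by linarith [hlh i])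
    simp_rw [h1]
    have h2 : ∀ i, 0 < 1 - l * h i := fun i => by linarith [hlh i]
    rw [← ENNReal.ofReal_prod_of_nonneg (fun i _ => (inv_nonneg.2 (h2 i).le))]
    refine ENNReal.ofReal_le_ofReal ?_
    calc ∏ i, (1 - l * h i)⁻¹
        ≤ ∏ i, Real.exp (l * h i + (l * h i) ^ 2 / (1 - l * h i)) :=
          Finset.prod_le_prod (fun i _ => (inv_nonneg.2 (h2 i).le))
            (fun i _ => inv_one_sub_le_exp (by linarith [h2 i]))
      _ = Real.exp (∑ i, (l * h i + (l * h i) ^ 2 / (1 - l * h i))) := (Real.exp_sum _ _).symm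
      _ ≤ _ := by
          refine Real.exp_le_exp.2 ?_
          -- An upper bound on the weights suffices: a negative `h i` only enlarges the denominator.
          have h3 : ∀ i, (l * h i) ^ 2 / (1 - l * h i) ≤ l ^ 2 / (1 - l * a) * h i ^ 2 := by
            intro i
            rw [mul_pow, div_mul_eq_mul_div (l ^ 2) (1 - l * a)]
            exact div_le_div_of_nonneg_left (by positivity) hla0 (sub_le_sub_left (hlh i) 1)
          calc ∑ i, (l * h i + (l * h i) ^ 2 / (1 - l * h i))
              ≤ ∑ i, (l * h i + l ^ 2 / (1 - l * a) * h i ^ 2) :=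
                Finset.sum_le_sum fun i _ => add_le_add le_rfl (h3 i)
            _ = l * ∑ i, h i + l ^ 2 / (1 - l * a) * ∑ i, h i ^ 2 := by
                rw [Finset.sum_add_distrib, Finset.mul_sum, Finset.mul_sum]
            _ ≤ l * ∑ i, h i + l ^ 2 / (1 - l * a) * p ^ 2 := by
                gcongr
            _ = l * B - q ^ 2 := by
                rw [hla, hB, hl]
                field_simp
                ring
  have h4 := hmarkov.trans hprod
  rw [sub_eq_add_neg, Real.exp_add, ENNReal.ofReal_mul (Real.exp_nonneg _)] at h4
  exact (ENNReal.mul_le_mul_iff_right (by simpa using Real.exp_pos _) ENNReal.ofReal_ne_top).1 h4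

variable {ι : Type*} [Fintype ι]

/-- Unitary invariance: the coordinates of a standard Gaussian vector in any orthonormal basis are
independent standard complex Gaussians. -/
lemma stdGaussian_preimage_repr {κ : Type*} [Fintype κ]
    (b : OrthonormalBasis κ ℂ (EuclideanSpace ℂ ι)) {s : Set (κ → ℂ)} (hs : MeasurableSet s) :
    stdGaussian (EuclideanSpace ℂ ι) {z | (fun i => inner ℂ (b i) z) ∈ s}
      = Measure.pi (fun _ : κ => stdGaussian ℂ) s := by
  let f : EuclideanSpace ℂ ι ≃ₗᵢ[ℝ] EuclideanSpace ℂ κ :=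
    { b.repr.toLinearEquiv.restrictScalars ℝ with norm_map' := b.repr.norm_map }
  have hf : ∀ z i, f z i = inner ℂ (b i) z := fun z i => b.repr_apply_apply z i
  have h1 := (stdGaussian_map f).trans map_pi_stdGaussian_complex.symm
  have hm : MeasurableSet ((WithLp.ofLp : EuclideanSpace ℂ κ → κ → ℂ) ⁻¹' s) :=
    (WithLp.measurable_ofLp 2 _) hs
  have h2 := congrArg (fun μ => μ ((WithLp.ofLp : EuclideanSpace ℂ κ → κ → ℂ) ⁻¹' s)) h1
  simp only at h2
  rw [Measure.map_apply (by fun_prop) hm, Measure.map_apply (by fun_prop) hm] at h2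
  have h3 : ((WithLp.toLp 2 : (κ → ℂ) → EuclideanSpace ℂ κ) ⁻¹'
    ((WithLp.ofLp : EuclideanSpace ℂ κ → κ → ℂ) ⁻¹' s)) = s := rfl
  rw [h3] at h2
  rw [← h2]
  congr 1
  ext z
  simp only [Set.mem_ofPred_eq, Set.mem_preimage]
  rw [show (fun i => inner ℂ (b i) z) = WithLp.ofLp (f z) from (funext fun i => hf z i).symm]

/-- The Hilbert-Schmidt norms of an operator and of its adjoint coincide, and they do not depend
on the orthonormal bases. -/
lemma sum_norm_sq_eq_sum_norm_sq_adjoint {κ κ' E : Type*} [Fintype κ] [Fintype κ']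
    [NormedAddCommGroup E] [InnerProductSpace ℂ E] {T T' : E →ₗ[ℂ] E}
    (h : ∀ x y, inner ℂ (T x) y = inner ℂ x (T' y))
    (b : OrthonormalBasis κ ℂ E) (c : OrthonormalBasis κ' ℂ E) :
    ∑ i, ‖T (b i)‖ ^ 2 = ∑ j, ‖T' (c j)‖ ^ 2 := by
  calc ∑ i, ‖T (b i)‖ ^ 2 = ∑ i, ∑ j, ‖inner ℂ (T (b i)) (c j)‖ ^ 2 :=
        Finset.sum_congr rfl fun i _ => (c.sum_sq_norm_inner_left _).symm
    _ = ∑ j, ∑ i, ‖inner ℂ (b i) (T' (c j))‖ ^ 2 := by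
        rw [Finset.sum_comm]
        exact Finset.sum_congr rfl fun j _ => Finset.sum_congr rfl fun i _ => by rw [h]
    _ = _ := Finset.sum_congr rfl fun j _ => b.sum_sq_norm_inner_right _

/-- A concentration inequality for Gaussian quadratic forms. -/
lemma quadraticForm_tail {T : EuclideanSpace ℂ ι →ₗ[ℂ] EuclideanSpace ℂ ι} (hT : T.IsSymmetric)
    {κ : Type*} [Fintype κ] (b : OrthonormalBasis κ ℂ (EuclideanSpace ℂ ι))
    {v a t : ℝ} (hv : 0 < v) (ha : 0 ≤ a) (ht : 0 ≤ t) (hHS : ∑ i, ‖T (b i)‖ ^ 2 ≤ v)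
    (hop : ∀ z, (inner ℂ z (T z)).re ≤ a * ‖z‖ ^ 2) :
    stdGaussian (EuclideanSpace ℂ ι)
      {z | 2 * (LinearMap.trace ℂ _ T).re + 4 * Real.sqrt (v * t) + 2 * a * t
        ≤ (inner ℂ z (T z)).re} ≤ ENNReal.ofReal (Real.exp (-t)) := by
  -- In an eigenbasis the form becomes a weighted sum of independent squared moduli.
  set u := hT.eigenvectorBasis rfl with hu
  set h := hT.eigenvalues rfl with hh
  have hTu : ∀ i, T (u i) = (h i : ℂ) • u i := fun i => hT.apply_eigenvectorBasis rfl i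
  have htr : (LinearMap.trace ℂ _ T).re = ∑ i, h i := hT.re_trace_eq_sum_eigenvalues rfl
  have hq : ∀ z, (inner ℂ z (T z)).re = ∑ i, h i * ‖inner ℂ (u i) z‖ ^ 2 := by
    intro z
    rw [← u.sum_inner_mul_inner, Complex.re_sum]
    refine Finset.sum_congr rfl fun i _ => ?_
    rw [← hT, hTu, inner_smul_left, Complex.conj_ofReal, mul_left_comm, ← inner_conj_symm z,
      mul_comm ((starRingEnd ℂ) _), Complex.mul_conj, Complex.normSq_eq_norm_sq,
      ← Complex.ofReal_mul, Complex.ofReal_re]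
  have hsq : ∑ i, h i ^ 2 ≤ v := by
    refine le_trans (le_of_eq ?_) hHS
    rw [sum_norm_sq_eq_sum_norm_sq_adjoint hT b u]
    refine Finset.sum_congr rfl fun i _ => ?_
    rw [hTu, norm_smul, u.norm_eq_one, mul_one, Complex.norm_real, Real.norm_eq_abs, sq_abs]
  have hmax : ∀ i, h i ≤ a := by
    intro i
    have := hop (u i)
    rw [hTu, inner_smul_right, inner_self_eq_norm_sq_to_K, u.norm_eq_one] at this
    simpa using this
  rw [htr]
  simp_rw [hq]
  refine le_trans (le_of_eq ?_) (weighted_sum_tail h hv ha ht hsq hmax)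
  exact stdGaussian_preimage_repr u (s := {w | 2 * ∑ i, h i + 4 * Real.sqrt (v * t) + 2 * a * t
    ≤ ∑ i, h i * ‖w i‖ ^ 2}) (measurableSet_le (by fun_prop) (by fun_prop))

end QuadraticForm

/-! ### Tails of sesquilinear forms and of families of linear functionals. -/

section GaussianTails

variable {ι : Type*} [Fintype ι]

lemma norm_apply_sq_le_sum_mul {κ E : Type*} [Fintype κ] [NormedAddCommGroup E]
    [InnerProductSpace ℂ E] {T : E →ₗ[ℂ] E} (hT : T.IsSymmetric) (b : OrthonormalBasis κ ℂ E)
    (z : E) : ‖T z‖ ^ 2 ≤ (∑ i, ‖T (b i)‖ ^ 2) * ‖z‖ ^ 2 := by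
  rw [← b.sum_sq_norm_inner_right, Finset.sum_mul]
  refine Finset.sum_le_sum fun i _ => ?_
  rw [← hT, ← mul_pow]
  exact pow_le_pow_left₀ (norm_nonneg _) (norm_inner_le_norm _ _) 2

/-- One-sided concentration for the real part of a Gaussian sesquilinear form. -/
lemma re_inner_apply_tail (K : EuclideanSpace ℂ ι →ₗ[ℂ] EuclideanSpace ℂ ι)
    {κ : Type*} [Fintype κ] (b : OrthonormalBasis κ ℂ (EuclideanSpace ℂ ι))
    {v t : ℝ} (hv : 0 < v) (ht : 0 ≤ t) (hHS : ∑ i, ‖K (b i)‖ ^ 2 ≤ v) :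
    stdGaussian (EuclideanSpace ℂ ι)
      {z | 2 * (LinearMap.trace ℂ _ K).re + 4 * Real.sqrt (v * t) + 2 * Real.sqrt v * t
        ≤ (inner ℂ z (K z)).re} ≤ ENNReal.ofReal (Real.exp (-t)) := by
  set K' := LinearMap.adjoint K with hK'
  have hadj : ∀ x y, inner ℂ (K x) y = inner ℂ x (K' y) := fun x y =>
    (LinearMap.adjoint_inner_right K x y).symm
  -- The Hermitian part of `K` has the same real part of the form and of the trace, and its
  -- Hilbert-Schmidt norm is no larger.
  set T : EuclideanSpace ℂ ι →ₗ[ℂ] EuclideanSpace ℂ ι := (2⁻¹ : ℂ) • (K + K') with hTdef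
  have hT : T.IsSymmetric := by
    intro x y
    simp only [hTdef, LinearMap.smul_apply, LinearMap.add_apply, inner_smul_left, inner_smul_right,
      inner_add_left, inner_add_right, hadj, map_inv₀, Complex.conj_ofNat]
    rw [hK', LinearMap.adjoint_inner_left, add_comm]
  have hquad : ∀ z, (inner ℂ z (T z)).re = (inner ℂ z (K z)).re := by
    intro z
    have h1 : inner ℂ z (K' z) = (starRingEnd ℂ) (inner ℂ z (K z)) := by
      rw [← hadj, inner_conj_symm]
    rw [hTdef, LinearMap.smul_apply, LinearMap.add_apply, inner_smul_right, inner_add_right, h1,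
      Complex.add_conj]
    simp
  have htr : (LinearMap.trace ℂ _ T).re = (LinearMap.trace ℂ _ K).re := by
    rw [LinearMap.trace_eq_sum_inner T b, LinearMap.trace_eq_sum_inner K b, Complex.re_sum,
      Complex.re_sum]
    exact Finset.sum_congr rfl fun i _ => hquad _
  have hTHS : ∑ i, ‖T (b i)‖ ^ 2 ≤ v := by
    have h1 : ∀ i, ‖T (b i)‖ ^ 2 ≤ 2⁻¹ * ‖K (b i)‖ ^ 2 + 2⁻¹ * ‖K' (b i)‖ ^ 2 := by
      intro i
      have h2 : ‖T (b i)‖ ≤ 2⁻¹ * (‖K (b i)‖ + ‖K' (b i)‖) := by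
        rw [hTdef, LinearMap.smul_apply, norm_smul, LinearMap.add_apply]
        norm_num
        exact norm_add_le _ _
      have h3 := pow_le_pow_left₀ (norm_nonneg _) h2 2
      nlinarith [sq_nonneg (‖K (b i)‖ - ‖K' (b i)‖)]
    calc ∑ i, ‖T (b i)‖ ^ 2 ≤ ∑ i, (2⁻¹ * ‖K (b i)‖ ^ 2 + 2⁻¹ * ‖K' (b i)‖ ^ 2) :=
          Finset.sum_le_sum fun i _ => h1 i
      _ = ∑ i, ‖K (b i)‖ ^ 2 := by
          rw [Finset.sum_add_distrib, ← Finset.mul_sum, ← Finset.mul_sum,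
            ← sum_norm_sq_eq_sum_norm_sq_adjoint hadj b b]
          ring
      _ ≤ v := hHS
  -- The operator norm is at most the Hilbert-Schmidt norm, whence the choice a = √v.
  have hop : ∀ z, (inner ℂ z (T z)).re ≤ Real.sqrt v * ‖z‖ ^ 2 := by
    intro z
    have h1 : ‖T z‖ ≤ Real.sqrt v * ‖z‖ := by
      refine abs_le_of_sq_le_sq' ?_ (by positivity) |>.2
      rw [mul_pow, Real.sq_sqrt hv.le]
      exact (norm_apply_sq_le_sum_mul hT b z).trans
        (mul_le_mul_of_nonneg_right hTHS (sq_nonneg _))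
    calc (inner ℂ z (T z)).re ≤ ‖z‖ * ‖T z‖ := re_inner_le_norm (𝕜 := ℂ) z (T z)
      _ ≤ ‖z‖ * (Real.sqrt v * ‖z‖) := mul_le_mul_of_nonneg_left h1 (norm_nonneg _)
      _ = _ := by ring
  have := quadraticForm_tail hT b hv (Real.sqrt_nonneg v) ht hTHS hop
  simp_rw [htr, hquad] at this
  exact this

/-- Concentration for a Gaussian sesquilinear form. -/
lemma norm_inner_apply_tail (K : EuclideanSpace ℂ ι →ₗ[ℂ] EuclideanSpace ℂ ι)
    {κ : Type*} [Fintype κ] (b : OrthonormalBasis κ ℂ (EuclideanSpace ℂ ι))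
    {v t : ℝ} (hv : 0 < v) (ht : 4 ≤ t) (hHS : ∑ i, ‖K (b i)‖ ^ 2 ≤ v) :
    stdGaussian (EuclideanSpace ℂ ι)
      {z | 2 * ‖LinearMap.trace ℂ _ K‖ + 8 * Real.sqrt v * t < ‖inner ℂ z (K z)‖}
      ≤ ENNReal.ofReal (4 * Real.exp (-t)) := by
  set β : ℝ := 4 * Real.sqrt v * t with hβ
  have hβ' : 4 * Real.sqrt (v * t) + 2 * Real.sqrt v * t ≤ β := by
    rw [Real.sqrt_mul hv.le, hβ]
    -- The assumption `4 ≤ t` lets the linear term of the deviation absorb the square-root term.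
    have h1 : 2 * Real.sqrt t ≤ t := by
      have h2 : 2 ≤ Real.sqrt t := Real.le_sqrt_of_sq_le (by linarith)
      nlinarith [Real.sq_sqrt (show 0 ≤ t by linarith)]
    nlinarith [mul_le_mul_of_nonneg_left h1 (Real.sqrt_nonneg v)]
  have key : ∀ c : ℂ, ‖c‖ = 1 → stdGaussian (EuclideanSpace ℂ ι)
      {z | 2 * (c * LinearMap.trace ℂ _ K).re + β ≤ (c * inner ℂ z (K z)).re}
      ≤ ENNReal.ofReal (Real.exp (-t)) := by
    intro c hc
    have h1 : ∑ i, ‖(c • K) (b i)‖ ^ 2 ≤ v := by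
      simpa [norm_smul, hc] using hHS
    refine (measure_mono ?_).trans (re_inner_apply_tail (c • K) b hv (by linarith) h1)
    intro z hz
    simp only [Set.mem_ofPred_eq, LinearMap.smul_apply, inner_smul_right, map_smul, smul_eq_mul]
      at hz ⊢
    linarith
  -- Rotating by 1, -1, I and -I bounds the real and imaginary deviations from the mean 2 tr K by β
  -- each, so the modulus deviates by at most 2β. This also explains the factor 4 in the
  -- probability.
  have hsub : {z | 2 * ‖LinearMap.trace ℂ _ K‖ + 8 * Real.sqrt v * t < ‖inner ℂ z (K z)‖} ⊆
      (({z | 2 * ((1 : ℂ) * LinearMap.trace ℂ _ K).re + β ≤ ((1 : ℂ) * inner ℂ z (K z)).re} ∪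
        {z | 2 * ((-1 : ℂ) * LinearMap.trace ℂ _ K).re + β ≤ ((-1 : ℂ) * inner ℂ z (K z)).re}) ∪
      ({z | 2 * (Complex.I * LinearMap.trace ℂ _ K).re + β ≤ (Complex.I * inner ℂ z (K z)).re} ∪
        {z | 2 * (-Complex.I * LinearMap.trace ℂ _ K).re + β
          ≤ (-Complex.I * inner ℂ z (K z)).re})) := by
    intro z hz
    by_contra hcon
    simp only [Set.mem_union, Set.mem_ofPred_eq, not_or, not_le, one_mul, neg_mul, Complex.neg_re,
      Complex.I_mul_re] at hcon hz
    obtain ⟨⟨h1, h2⟩, h3, h4⟩ := hcon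
    have h5 : ‖inner ℂ z (K z) - 2 * LinearMap.trace ℂ _ K‖ ≤ 2 * β := by
      refine (Complex.norm_le_abs_re_add_abs_im _).trans ?_
      have h6 : |(inner ℂ z (K z) - 2 * LinearMap.trace ℂ _ K).re| ≤ β := by
        rw [abs_le]; simp; constructor <;> linarith
      have h7 : |(inner ℂ z (K z) - 2 * LinearMap.trace ℂ _ K).im| ≤ β := by
        rw [abs_le]; simp; constructor <;> linarith
      linarith
    have h8 : ‖inner ℂ z (K z)‖ ≤ ‖inner ℂ z (K z) - 2 * LinearMap.trace ℂ _ K‖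
        + ‖2 * LinearMap.trace ℂ _ K‖ := by
      simpa using norm_add_le (inner ℂ z (K z) - 2 * LinearMap.trace ℂ _ K)
        (2 * LinearMap.trace ℂ _ K)
    rw [norm_mul, Complex.norm_ofNat] at h8
    linarith
  refine (measure_mono hsub).trans ((measure_union_le _ _).trans
    ((add_le_add (measure_union_le _ _) (measure_union_le _ _)).trans
      ((add_le_add (add_le_add (key 1 (by simp)) (key (-1) (by simp)))
        (add_le_add (key Complex.I (by simp)) (key (-Complex.I) (by simp)))).trans (le_of_eq ?_))))
  have := Real.exp_nonneg (-t)
  rw [← ENNReal.ofReal_add this this, ← ENNReal.ofReal_add (by linarith) (by linarith)]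
  congr 1
  ring

/-- The tail of the modulus of a linear functional of a standard Gaussian vector. -/
lemma norm_inner_tail {a : EuclideanSpace ℂ ι} (ha : a ≠ 0) {t : ℝ} (ht : 0 ≤ t) :
    stdGaussian (EuclideanSpace ℂ ι) {z | ‖a‖ ^ 2 * (2 * t) ≤ ‖inner ℂ a z‖ ^ 2}
      = ENNReal.ofReal (Real.exp (-t)) := by
  have hna : 0 < ‖a‖ := norm_pos_iff.2 ha
  set e : EuclideanSpace ℂ ι := ((‖a‖⁻¹ : ℝ) : ℂ) • a with he
  have hea : a = (‖a‖ : ℂ) • e := by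
    rw [he, smul_smul, ← Complex.ofReal_mul, mul_inv_cancel₀ hna.ne', Complex.ofReal_one, one_smul]
  have hne : ‖e‖ = 1 := by
    rw [he, norm_smul, Complex.norm_real, norm_inv, norm_norm, inv_mul_cancel₀ hna.ne']
  -- Once `e` is completed to an orthonormal basis, `inner ℂ e z` is a single coordinate.
  have horth : Orthonormal ℂ (Subtype.val : ({e} : Set (EuclideanSpace ℂ ι)) → _) := by
    constructor
    · rintro ⟨x, rfl⟩; exact hne
    · rintro ⟨x, rfl⟩ ⟨y, rfl⟩ h; exact absurd rfl h
  obtain ⟨u, b, hsub, hb⟩ := horth.exists_orthonormalBasis_extension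
  have heu : e ∈ u := by simpa using hsub
  have hbe : b ⟨e, heu⟩ = e := by rw [hb]
  have h1 := stdGaussian_preimage_repr b (s := {w | 2 * t ≤ ‖w ⟨e, heu⟩‖ ^ 2})
    (measurableSet_le measurable_const (by fun_prop))
  have h2 := (measurePreserving_eval (fun _ : u => stdGaussian ℂ) ⟨e, heu⟩).measure_preimage
    (s := {w : ℂ | 2 * t ≤ ‖w‖ ^ 2})
    (measurableSet_le measurable_const (by fun_prop)).nullMeasurableSet
  rw [← stdGaussian_complex_tail ht, ← h2]
  refine Eq.trans ?_ h1
  congr 1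
  ext z
  simp only [Set.mem_ofPred_eq, hbe]
  have h3 : ‖inner ℂ a z‖ ^ 2 = ‖a‖ ^ 2 * ‖inner ℂ e z‖ ^ 2 := by
    conv_lhs => rw [hea]
    rw [inner_smul_left, norm_mul, mul_pow]
    simp
  rw [h3, mul_le_mul_iff_right₀ (by positivity)]

/-- Converts the tail of a functional with energy share `p` into a probability proportional to `p`;
since the shares sum to at most one, the union bound costs nothing. -/
lemma exp_neg_div_le {p t : ℝ} (hp : 0 < p) (hp1 : p ≤ 1) (ht : 1 ≤ t) :
    Real.exp (-(t / p)) ≤ p * Real.exp (-t) := by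
  have h1 : p⁻¹ ≤ Real.exp (p⁻¹ - 1) := by linarith [Real.add_one_le_exp (p⁻¹ - 1)]
  have h2 : 1 ≤ p⁻¹ := (one_le_inv₀ hp).2 hp1
  have h3 : Real.exp (-(t / p)) ≤ Real.exp (-(p⁻¹ - 1)) * Real.exp (-t) := by
    rw [← Real.exp_add, Real.exp_le_exp, div_eq_mul_inv]
    nlinarith
  refine h3.trans (mul_le_mul_of_nonneg_right ?_ (Real.exp_nonneg _))
  rw [Real.exp_neg]
  exact inv_le_of_inv_le₀ hp h1

/-- A union bound for linear functionals of a standard Gaussian vector, which takes the total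
energy of the functionals into account. -/
lemma exists_norm_inner_tail {κ : Type*} (s : Finset κ) (a : κ → EuclideanSpace ℂ ι) {B t : ℝ}
    (hB : 0 ≤ B) (ht : 1 ≤ t) (hsum : ∑ k ∈ s, ‖a k‖ ^ 2 ≤ B ^ 2) :
    stdGaussian (EuclideanSpace ℂ ι) {z | ∃ k ∈ s, B * Real.sqrt (2 * t) < ‖inner ℂ (a k) z‖}
      ≤ ENNReal.ofReal (Real.exp (-t)) := by
  have hle : ∀ k ∈ s, ‖a k‖ ^ 2 ≤ B ^ 2 := fun k hk =>
    (Finset.single_le_sum (f := fun k => ‖a k‖ ^ 2) (fun i _ => sq_nonneg _) hk).trans hsum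
  rcases hB.eq_or_lt with rfl | hB
  · refine le_trans (le_of_eq ?_) zero_le
    convert measure_empty (μ := stdGaussian (EuclideanSpace ℂ ι))
    refine Set.eq_empty_of_forall_notMem ?_
    rintro z ⟨k, hk, h⟩
    have h0 : a k = 0 := by
      have := hle k hk
      have h1 : ‖a k‖ = 0 := by nlinarith [norm_nonneg (a k)]
      simpa using h1
    simp [h0] at h
  -- A functional of smaller norm passes the common level B√(2t) only at the rescaled parameter t
  -- B²/‖a k‖².
  · have hone : ∀ k ∈ s, stdGaussian (EuclideanSpace ℂ ι)
        {z | B * Real.sqrt (2 * t) < ‖inner ℂ (a k) z‖}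
        ≤ ENNReal.ofReal (‖a k‖ ^ 2 / B ^ 2 * Real.exp (-t)) := by
      intro k hk
      by_cases h0 : a k = 0
      · refine le_trans (le_of_eq ?_) zero_le
        convert measure_empty (μ := stdGaussian (EuclideanSpace ℂ ι))
        ext z
        simp only [h0, inner_zero_left, norm_zero, Set.mem_ofPred_eq, Set.mem_empty_iff_false,
          iff_false, not_lt]
        positivity
      · have hpos : 0 < ‖a k‖ := norm_pos_iff.2 h0
        have h1 : 0 < ‖a k‖ ^ 2 / B ^ 2 := by positivity
        have h2 : ‖a k‖ ^ 2 / B ^ 2 ≤ 1 := div_le_one_of_le₀ (hle k hk) (by positivity)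
        refine (measure_mono ?_).trans ((norm_inner_tail h0
          (t := t / (‖a k‖ ^ 2 / B ^ 2)) (by positivity)).le.trans
          (ENNReal.ofReal_le_ofReal (exp_neg_div_le h1 h2 ht)))
        intro z hz
        simp only [Set.mem_ofPred_eq] at hz ⊢
        have h3 := pow_le_pow_left₀ (by positivity) hz.le 2
        rw [mul_pow, Real.sq_sqrt (by linarith)] at h3
        refine le_trans (le_of_eq ?_) h3
        field_simp
    have hsub : {z | ∃ k ∈ s, B * Real.sqrt (2 * t) < ‖inner ℂ (a k) z‖}
        ⊆ ⋃ k ∈ s, {z | B * Real.sqrt (2 * t) < ‖inner ℂ (a k) z‖} := by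
      rintro z ⟨k, hk, h⟩
      exact Set.mem_biUnion hk h
    refine (measure_mono hsub).trans ((measure_biUnion_finset_le s _).trans
      ((Finset.sum_le_sum hone).trans ?_))
    rw [← ENNReal.ofReal_sum_of_nonneg (fun k _ => by positivity), ← Finset.sum_mul,
      ← Finset.sum_div]
    refine ENNReal.ofReal_le_ofReal ?_
    have : (∑ k ∈ s, ‖a k‖ ^ 2) / B ^ 2 ≤ 1 := div_le_one_of_le₀ hsum (by positivity)
    nlinarith [Real.exp_nonneg (-t)]

/-- The vector of the observed noise is a standard Gaussian vector. -/
lemma IsComplexWhiteNoise.map_eq_stdGaussian {Ω : Type*} [MeasurableSpace Ω] {μ : Measure Ω}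
    [IsProbabilityMeasure μ] {I : Set ℤ} [Fintype I] {ζ : ℤ → Ω → ℂ}
    (h : IsComplexWhiteNoise μ I ζ) :
    μ.map (fun ω => (WithLp.toLp 2 (fun t : I => ζ t ω) : EuclideanSpace ℂ I))
      = stdGaussian (EuclideanSpace ℂ I) := by
  have hm : ∀ t : I, Measurable (ζ t) := fun t => h.measurable t t.2
  have h1 := (iIndepFun_iff_map_fun_eq_pi_map (fun t : I => (hm t).aemeasurable)).1 h.indep
  have h2 : ∀ t : I, μ.map (ζ t) = stdGaussian ℂ := by
    intro t
    have hp : Measurable fun ω => ((ζ t ω).re, (ζ t ω).im) :=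
      (Complex.measurable_re.comp (hm t)).prodMk (Complex.measurable_im.comp (hm t))
    rw [← map_prod_gaussianReal_eq_stdGaussian, ← h.law t t.2, Measure.map_map (by fun_prop) hp]
    rfl
  simp_rw [h2] at h1
  rw [← map_pi_stdGaussian_complex, ← h1, Measure.map_map (by fun_prop)
    (measurable_pi_lambda _ hm)]
  rfl

end GaussianTails

/-! ### Roots of unity and sums of Dirichlet kernels. -/

section Fourier

/-- The primitive `N`-th root of unity `e^{2πi/N}`. -/
def omega (N : ℕ) : ℂ := Complex.exp (2 * Real.pi * Complex.I / N)

lemma omega_ne_zero (N : ℕ) : omega N ≠ 0 := Complex.exp_ne_zero _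

lemma omega_zpow (N : ℕ) (k : ℤ) :
    omega N ^ k = Complex.exp (2 * Real.pi * (k / N : ℝ) * Complex.I) := by
  rw [omega, ← Complex.exp_int_mul]
  congr 1
  push_cast
  ring

lemma norm_omega_zpow (N : ℕ) (k : ℤ) : ‖omega N ^ k‖ = 1 := by
  rw [omega_zpow]
  have := Complex.norm_exp_ofReal_mul_I (2 * Real.pi * (k / N : ℝ))
  push_cast at this ⊢
  exact this

lemma conj_omega_zpow (N : ℕ) (k : ℤ) : (starRingEnd ℂ) (omega N ^ k) = omega N ^ (-k) := by
  rw [zpow_neg, Complex.inv_eq_conj (norm_omega_zpow N k)]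

lemma isPrimitiveRoot_omega {N : ℕ} (hN : N ≠ 0) : IsPrimitiveRoot (omega N) N :=
  Complex.isPrimitiveRoot_exp N hN

/-- Orthogonality of the characters of `ℤ/Nℤ`. -/
lemma sum_omega_zpow {N : ℕ} (hN : N ≠ 0) (d : ℤ) :
    ∑ j ∈ Finset.range N, omega N ^ ((j : ℤ) * d) = if (N : ℤ) ∣ d then (N : ℂ) else 0 := by
  have h1 : ∀ j : ℕ, omega N ^ ((j : ℤ) * d) = (omega N ^ d) ^ j := fun j => by
    rw [mul_comm, zpow_mul, zpow_natCast]
  simp_rw [h1]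
  split_ifs with hd
  · rw [((isPrimitiveRoot_omega hN).zpow_eq_one_iff_dvd d).2 hd]
    simp
  · have hne : omega N ^ d ≠ 1 := fun h =>
      hd (((isPrimitiveRoot_omega hN).zpow_eq_one_iff_dvd d).1 h)
    rw [geom_sum_eq hne, ← zpow_natCast, ← zpow_mul, mul_comm, zpow_mul, zpow_natCast,
      (isPrimitiveRoot_omega hN).pow_eq_one, one_zpow, sub_self, zero_div]

/-- The unit complex number of argument `2 π y`. -/
def unitExp (y : ℝ) : ℂ := Complex.exp (2 * Real.pi * y * Complex.I)

lemma unitExp_add_intCast (y : ℝ) (k : ℤ) : unitExp (y + k) = unitExp y := by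
  have := Complex.exp_periodic.int_mul k (2 * Real.pi * y * Complex.I)
  rw [unitExp, unitExp, ← this]
  congr 1
  push_cast
  ring

lemma norm_unitExp (y : ℝ) : ‖unitExp y‖ = 1 := by
  have := Complex.norm_exp_ofReal_mul_I (2 * Real.pi * y)
  rw [unitExp]
  push_cast at this
  exact this

lemma norm_sum_unitExp_pow_le (M : ℕ) (y : ℝ) :
    ‖∑ τ ∈ Finset.range M, unitExp y ^ τ‖ ≤ M := by
  refine (norm_sum_le _ _).trans (le_of_eq ?_)
  simp [norm_unitExp]

/-- The standard bound for the Dirichlet kernel. -/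
lemma norm_sum_unitExp_pow_le_inv (M : ℕ) {y : ℝ} (h0 : 0 < y) (h1 : y < 1) :
    ‖∑ τ ∈ Finset.range M, unitExp y ^ τ‖ ≤ 2⁻¹ * (y⁻¹ + (1 - y)⁻¹) := by
  have hpi := Real.pi_pos
  -- Jordan's inequality on each half of the interval, in a symmetric form suited to 1/(y(1-y)) =
  -- 1/y + 1/(1-y).
  have hsin : 2 * (y * (1 - y)) ≤ Real.sin (Real.pi * y) := by
    rcases le_total y (1 / 2) with h | h
    · have := Real.mul_le_sin (x := Real.pi * y) (by positivity) (by nlinarith)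
      rw [show 2 / Real.pi * (Real.pi * y) = 2 * y by field_simp] at this
      nlinarith
    · have := Real.mul_le_sin (x := Real.pi * (1 - y)) (by nlinarith) (by nlinarith)
      rw [show 2 / Real.pi * (Real.pi * (1 - y)) = 2 * (1 - y) by field_simp,
        show Real.pi * (1 - y) = Real.pi - Real.pi * y by ring, Real.sin_pi_sub] at this
      nlinarith
  have hden : ‖unitExp y - 1‖ = 2 * Real.sin (Real.pi * y) := by
    have := Complex.norm_exp_I_mul_ofReal_sub_one (2 * Real.pi * y)
    rw [unitExp, mul_comm _ Complex.I]
    push_cast at this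
    rw [this, show 2 * Real.pi * y / 2 = Real.pi * y by ring, Real.norm_eq_abs, abs_of_nonneg]
    nlinarith
  have hpos : 0 < y * (1 - y) := mul_pos h0 (by linarith)
  have hne : unitExp y ≠ 1 := by
    intro h
    rw [h, sub_self, norm_zero] at hden
    linarith
  rw [geom_sum_eq hne, norm_div, hden, div_le_iff₀ (by linarith)]
  have hnum : ‖unitExp y ^ M - 1‖ ≤ 2 := by
    refine (norm_sub_le _ _).trans (le_of_eq ?_)
    rw [norm_pow, norm_unitExp]
    norm_num
  have hsum : 2⁻¹ * (y⁻¹ + (1 - y)⁻¹) = 2⁻¹ * (y * (1 - y))⁻¹ := by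
    have : 1 - y ≠ 0 := by linarith
    field_simp
    ring
  rw [hsum]
  refine hnum.trans ?_
  have : 2⁻¹ * (y * (1 - y))⁻¹ * (2 * (2 * (y * (1 - y)))) = 2 := by
    have h2 : 1 - y ≠ 0 := by linarith
    field_simp
  calc (2 : ℝ) = 2⁻¹ * (y * (1 - y))⁻¹ * (2 * (2 * (y * (1 - y)))) := this.symm
    _ ≤ _ := by gcongr

/-- Moving the window by one step drops `g q` and adds `g (q + N)`, which are equal. -/
lemma sum_range_add_of_periodic {N : ℕ} (g : ℤ → ℝ) (hg : ∀ l, g (l + N) = g l) (q : ℤ) :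
    ∑ j ∈ Finset.range N, g (q + j) = ∑ j ∈ Finset.range N, g j := by
  have step : ∀ q : ℤ, ∑ j ∈ Finset.range N, g (q + 1 + j) = ∑ j ∈ Finset.range N, g (q + j) := by
    intro q
    have h1 := Finset.sum_range_succ (fun j : ℕ => g (q + j)) N
    have h2 := Finset.sum_range_succ' (fun j : ℕ => g (q + j)) N
    have h3 : ∀ j : ℕ, g (q + 1 + j) = g (q + ((j + 1 : ℕ) : ℤ)) := fun j => by
      congr 1; push_cast; ring
    simp_rw [h3]
    simp only [hg, Nat.cast_zero, add_zero] at h1 h2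
    linarith
  induction q using Int.induction_on with
  | zero => simp
  | succ i ih => rw [step, ih]
  | pred i ih => rw [← ih, ← step (-(i : ℤ) - 1), sub_add_cancel]

/-- The term `l = 0` vanishes because `0⁻¹ = 0`, so this is a harmonic sum. -/
lemma sum_inv_range_le {N : ℕ} (hN : N ≠ 0) :
    ∑ l ∈ Finset.range N, ((l : ℝ))⁻¹ ≤ 1 + Real.log N := by
  obtain ⟨N, rfl⟩ := Nat.exists_eq_succ_of_ne_zero hN
  rw [Nat.succ_eq_add_one, Finset.sum_range_succ']
  have h1 := harmonic_le_one_add_log N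
  have h2 : ((harmonic N : ℚ) : ℝ) = ∑ i ∈ Finset.range N, (((i + 1 : ℕ) : ℝ))⁻¹ := by
    rw [harmonic]; push_cast; rfl
  rw [h2] at h1
  have h3 : Real.log N ≤ Real.log ((N + 1 : ℕ) : ℝ) := by
    rcases Nat.eq_zero_or_pos N with rfl | h
    · simp
    · exact Real.log_le_log (by exact_mod_cast h) (by push_cast; linarith)
  simp only [Nat.cast_zero, inv_zero, add_zero]
  linarith

/-- The sum of the Dirichlet kernel over a shifted regular grid. -/
lemma sum_norm_dirichlet_le {N : ℕ} (hN : N ≠ 0) (M : ℕ) (x : ℝ) :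
    ∑ j ∈ Finset.range N, ‖∑ τ ∈ Finset.range M, unitExp (x + j / N) ^ τ‖
      ≤ 2 * M + N * (1 + Real.log N) := by
  have hN0 : (0 : ℝ) < N := by exact_mod_cast Nat.pos_of_ne_zero hN
  -- By periodicity the grid may be translated so that its offset is δ/N with 0 ≤ δ < 1.
  set δ : ℝ := Int.fract (N * x) with hδ
  have hδ0 : 0 ≤ δ := Int.fract_nonneg _
  have hδ1 : δ < 1 := Int.fract_lt_one _
  set g : ℤ → ℝ := fun l => ‖∑ τ ∈ Finset.range M, unitExp ((δ + l) / N) ^ τ‖ with hg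
  have hper : ∀ l, g (l + N) = g l := by
    intro l
    have : (δ + ((l + N : ℤ) : ℝ)) / N = (δ + l) / N + ((1 : ℤ) : ℝ) := by
      push_cast; field_simp; ring
    simp only [hg]
    rw [this, unitExp_add_intCast]
  have h1 : ∀ j : ℕ, ‖∑ τ ∈ Finset.range M, unitExp (x + j / N) ^ τ‖ = g (⌊N * x⌋ + j) := by
    intro j
    have : x + j / N = (δ + ((⌊N * x⌋ + j : ℤ) : ℝ)) / N := by
      rw [hδ, Int.fract]; push_cast; field_simp; ring
    rw [this]
  simp_rw [h1]
  rw [sum_range_add_of_periodic g hper]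
  -- The end points `l = 0` and `l = N - 1` may lie too close to an integer and get the trivial
  -- bound `M`. The convention `0⁻¹ = 0` keeps the last summand harmless there.
  have h2 : ∀ l ∈ Finset.range N, g l ≤ (if l = 0 then (M : ℝ) else 0)
      + (if l = N - 1 then (M : ℝ) else 0)
      + N * 2⁻¹ * ((l : ℝ)⁻¹ + ((N - 1 - l : ℕ) : ℝ)⁻¹) := by
    intro l hl
    have hlN := Finset.mem_range.1 hl
    have hM : g l ≤ M := norm_sum_unitExp_pow_le M _
    have hnn : (0 : ℝ) ≤ N * 2⁻¹ * ((l : ℝ)⁻¹ + ((N - 1 - l : ℕ) : ℝ)⁻¹) := by positivity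
    have hM0 : (0 : ℝ) ≤ M := Nat.cast_nonneg M
    by_cases hl0 : l = 0
    · rw [if_pos hl0]
      split_ifs <;> linarith
    by_cases hl1 : l = N - 1
    · rw [if_pos hl1, if_neg hl0]
      linarith
    rw [if_neg hl0, if_neg hl1, zero_add, zero_add]
    have hlpos : (0 : ℝ) < l := by exact_mod_cast Nat.pos_of_ne_zero hl0
    have hcast : ((N - 1 - l : ℕ) : ℝ) = N - 1 - l := by
      rw [Nat.cast_sub (by omega), Nat.cast_sub (by omega), Nat.cast_one]
    have hlpos' : (0 : ℝ) < N - 1 - l := by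
      rw [← hcast]; exact_mod_cast (show 0 < N - 1 - l by omega)
    have hy := norm_sum_unitExp_pow_le_inv M (y := (δ + l) / N) (by positivity)
      (by rw [div_lt_one hN0]; linarith)
    refine hy.trans ?_
    have e1 : ((δ + l) / N)⁻¹ ≤ N * (l : ℝ)⁻¹ := by
      rw [inv_div, div_eq_mul_inv]
      gcongr
      linarith
    have e2 : (1 - (δ + l) / N)⁻¹ ≤ N * ((N : ℝ) - 1 - l)⁻¹ := by
      rw [show 1 - (δ + l) / N = (N - (δ + l)) / N by field_simp, inv_div, div_eq_mul_inv]
      exact mul_le_mul_of_nonneg_left (inv_anti₀ hlpos' (by linarith)) hN0.le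
    rw [hcast]
    linarith
  refine (Finset.sum_le_sum h2).trans ?_
  have h3 : ∑ l ∈ Finset.range N, ((N - 1 - l : ℕ) : ℝ)⁻¹ = ∑ l ∈ Finset.range N, (l : ℝ)⁻¹ :=
    Finset.sum_range_reflect (fun l : ℕ => (l : ℝ)⁻¹) N
  rw [Finset.sum_add_distrib, Finset.sum_add_distrib, ← Finset.mul_sum, Finset.sum_add_distrib, h3,
    Finset.sum_ite_eq' (Finset.range N) 0, Finset.sum_ite_eq' (Finset.range N) (N - 1)]
  rw [if_pos (Finset.mem_range.2 (Nat.pos_of_ne_zero hN)),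
    if_pos (Finset.mem_range.2 (Nat.sub_lt (Nat.pos_of_ne_zero hN) one_pos))]
  have := mul_le_mul_of_nonneg_left (sum_inv_range_le hN) hN0.le
  linarith

end Fourier

/-! ### Convolutions as operators on the window: circulant structure, trace, Hilbert-Schmidt norm.
-/

section Operators

/-- The space of complex vectors indexed by the observation window `[-m, n]`. -/
abbrev WindowSpace (m n : ℕ) : Type := EuclideanSpace ℂ (Set.Icc (-(m : ℤ)) (n : ℤ))

/-- The restriction of a sequence to `[0, n]`, as a vector on the window `[-m, n]`. -/
def restr (m n : ℕ) : (ℤ → ℂ) →ₗ[ℂ] WindowSpace m n where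
  toFun x := WithLp.toLp 2 (fun t => if 0 ≤ (t : ℤ) then x t else 0)
  map_add' x y := by ext t; by_cases h : 0 ≤ (t : ℤ) <;> simp [h]
  map_smul' c x := by ext t; by_cases h : 0 ≤ (t : ℤ) <;> simp [h]

/-- The extension by zero of a vector on the window. -/
def extend (m n : ℕ) : WindowSpace m n →ₗ[ℂ] (ℤ → ℂ) where
  toFun z := fun t => if h : t ∈ Set.Icc (-(m : ℤ)) (n : ℤ) then z ⟨t, h⟩ else 0
  map_add' x y := by
    funext t
    by_cases h : t ∈ Set.Icc (-(m : ℤ)) (n : ℤ) <;>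
      simp only [Pi.add_apply, h, dite_true, dite_false, PiLp.add_apply, add_zero]
  map_smul' c x := by
    funext t
    by_cases h : t ∈ Set.Icc (-(m : ℤ)) (n : ℤ) <;>
      simp only [Pi.smul_apply, h, dite_true, dite_false, PiLp.smul_apply, smul_zero,
        RingHom.id_apply]

/-- The convolution with the filter which coincides with `u` on `[0, m]` and vanishes elsewhere. -/
def filt (m : ℕ) (u : ℤ → ℂ) : (ℤ → ℂ) →ₗ[ℂ] (ℤ → ℂ) where
  toFun x := fun t => ∑ τ ∈ Finset.range (m + 1), u τ * x (t - τ)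
  map_add' x y := by
    funext t
    simp only [Pi.add_apply, mul_add, Finset.sum_add_distrib]
  map_smul' c x := by
    funext t
    simp only [Pi.smul_apply, smul_eq_mul, RingHom.id_apply, Finset.mul_sum]
    exact Finset.sum_congr rfl fun _ _ => by ring

variable {m n : ℕ}

lemma restr_apply (x : ℤ → ℂ) (t : Set.Icc (-(m : ℤ)) (n : ℤ)) :
    restr m n x t = if 0 ≤ (t : ℤ) then x t else 0 := rfl

lemma extend_apply (z : WindowSpace m n) {t : ℤ} (h : t ∈ Set.Icc (-(m : ℤ)) (n : ℤ)) :
    extend m n z t = z ⟨t, h⟩ := dif_pos h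

lemma filt_apply (u x : ℤ → ℂ) (t : ℤ) :
    filt m u x t = ∑ τ ∈ Finset.range (m + 1), u τ * x (t - τ) := rfl

lemma sum_window {A : Type*} [AddCommMonoid A] (f : ℤ → A) :
    ∑ t : Set.Icc (-(m : ℤ)) (n : ℤ), (if 0 ≤ (t : ℤ) then f t else 0)
      = ∑ t ∈ Finset.range (n + 1), f (t : ℤ) := by
  rw [← Finset.sum_filter]
  refine Finset.sum_bij' (fun t _ => (t : ℤ).toNat)
    (fun t ht => ⟨(t : ℤ), by
      have := Finset.mem_range.1 ht
      exact ⟨by omega, by omega⟩⟩) ?_ ?_ ?_ ?_ ?_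
  · rintro ⟨t, h1, h2⟩ ht
    have h3 : 0 ≤ t := (Finset.mem_filter.1 ht).2
    simp only [Finset.mem_range]
    omega
  · intro t ht
    simp
  · rintro ⟨t, h1, h2⟩ ht
    have h3 : 0 ≤ t := (Finset.mem_filter.1 ht).2
    simp [Int.toNat_of_nonneg h3]
  · intro t ht
    simp
  · rintro ⟨t, h1, h2⟩ ht
    have h3 : 0 ≤ t := (Finset.mem_filter.1 ht).2
    simp [Int.toNat_of_nonneg h3]

/-- Padding by zeros at negative times does not affect the norm. It places `[0, n]` and `[-m, n]` in
one space, so that pairing the noise with its filtered version is a quadratic form. -/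
lemma norm_restr_sq (x : ℤ → ℂ) :
    ‖restr m n x‖ ^ 2 = ∑ t ∈ Finset.range (n + 1), ‖x (t : ℤ)‖ ^ 2 := by
  rw [EuclideanSpace.norm_sq_eq, ← sum_window (m := m) (fun t => ‖x t‖ ^ 2)]
  refine Finset.sum_congr rfl fun t _ => ?_
  rw [restr_apply]
  split_ifs <;> simp

lemma norm_restr (x : ℤ → ℂ) : ‖restr m n x‖ = l2norm n x := by
  rw [l2norm, ← norm_restr_sq (m := m), Real.sqrt_sq (norm_nonneg _)]

lemma restr_extend_apply (z : WindowSpace m n) (t : Set.Icc (-(m : ℤ)) (n : ℤ)) :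
    restr m n (extend m n z) t = if 0 ≤ (t : ℤ) then z t else 0 := by
  rw [restr_apply, extend_apply z t.2]

/-- The coordinate projection of the window onto `[0, n]` is self-adjoint. -/
lemma inner_restr_extend (x z : WindowSpace m n) :
    inner ℂ (restr m n (extend m n x)) z = inner ℂ x (restr m n (extend m n z)) := by
  rw [PiLp.inner_apply, PiLp.inner_apply]
  refine Finset.sum_congr rfl fun t _ => ?_
  rw [restr_extend_apply, restr_extend_apply]
  split_ifs <;> simp

lemma norm_restr_extend_le (z : WindowSpace m n) : ‖restr m n (extend m n z)‖ ≤ ‖z‖ := by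
  rw [EuclideanSpace.norm_eq, EuclideanSpace.norm_eq]
  refine Real.sqrt_le_sqrt (Finset.sum_le_sum fun t _ => ?_)
  rw [restr_extend_apply]
  split_ifs <;> simp

/-- The convolution operator on the window, followed by the restriction to `[0, n]`. -/
def windowConv (m n : ℕ) (u : ℤ → ℂ) : WindowSpace m n →ₗ[ℂ] WindowSpace m n :=
  restr m n ∘ₗ filt m u ∘ₗ extend m n

lemma windowConv_apply (u : ℤ → ℂ) (z : WindowSpace m n) (t : Set.Icc (-(m : ℤ)) (n : ℤ)) :
    windowConv m n u z t = ∑ i : Set.Icc (-(m : ℤ)) (n : ℤ),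
      (if 0 ≤ (t : ℤ) ∧ 0 ≤ (t : ℤ) - i ∧ (t : ℤ) - i ≤ m then u (t - i) else 0) * z i := by
  have h0 : windowConv m n u z t = if 0 ≤ (t : ℤ) then filt m u (extend m n z) t else 0 := rfl
  rw [h0]
  split_ifs with ht
  · rw [filt_apply]
    simp_rw [ite_mul, zero_mul]
    rw [← Finset.sum_filter]
    refine Finset.sum_bij' (fun τ hτ => ⟨(t : ℤ) - τ, by
      have := Finset.mem_range.1 hτ
      have := t.2.1
      have := t.2.2
      exact ⟨by omega, by omega⟩⟩) (fun i _ => ((t : ℤ) - i).toNat) ?_ ?_ ?_ ?_ ?_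
    · intro τ hτ
      have := Finset.mem_range.1 hτ
      simp only [Finset.mem_filter, Finset.mem_univ, true_and, sub_sub_cancel]
      omega
    · intro i hi
      have := (Finset.mem_filter.1 hi).2
      rw [Finset.mem_range]
      omega
    · intro τ hτ
      simp
    · intro i hi
      have := (Finset.mem_filter.1 hi).2
      ext
      simp [Int.toNat_of_nonneg this.2.1]
    · intro τ hτ
      have hmem : (t : ℤ) - τ ∈ Set.Icc (-(m : ℤ)) (n : ℤ) := by
        have := Finset.mem_range.1 hτ
        have := t.2.1
        have := t.2.2
        exact ⟨by omega, by omega⟩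
      simp only [sub_sub_cancel]
      rw [extend_apply z hmem]
  · simp [ht]

/-- The characters of `ℤ/Nℤ`. -/
def character (N j : ℕ) (t : ℤ) : ℂ := omega N ^ (-((j : ℤ) * t))

/-- The transfer function of the filter `u` at the points of `ℤ/Nℤ`. -/
def transfer (m N : ℕ) (u : ℤ → ℂ) (j : ℕ) : ℂ :=
  ∑ τ ∈ Finset.range (m + 1), u τ * omega N ^ ((j : ℤ) * τ)

/-- On the window, a filter acts as a circulant operator. -/
lemma sum_transfer_mul_character (u : ℤ → ℂ) {t i : ℤ} (ht0 : 0 ≤ t) (htn : t ≤ n)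
    (him : -(m : ℤ) ≤ i) (hin : i ≤ n) :
    ∑ j ∈ Finset.range (m + n + 1), transfer m (m + n + 1) u j / ((m + n + 1 : ℕ) : ℂ) *
        (omega (m + n + 1) ^ ((j : ℤ) * i) * character (m + n + 1) j t)
      = if 0 ≤ t - i ∧ t - i ≤ m then u (t - i) else 0 := by
  set N := m + n + 1 with hN
  have hN0 : N ≠ 0 := by omega
  have hNC : (N : ℂ) ≠ 0 := by exact_mod_cast hN0
  have h1 : ∀ j ∈ Finset.range N, transfer m N u j / (N : ℂ) *
      (omega N ^ ((j : ℤ) * i) * character N j t)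
      = ∑ τ ∈ Finset.range (m + 1), u τ / N * omega N ^ ((j : ℤ) * (τ + i - t)) := by
    intro j _
    rw [transfer, Finset.sum_div, Finset.sum_mul]
    refine Finset.sum_congr rfl fun τ _ => ?_
    rw [character, show (j : ℤ) * (τ + i - t) = j * τ + (j * i + -(j * t)) by ring,
      zpow_add₀ (omega_ne_zero N), zpow_add₀ (omega_ne_zero N)]
    ring
  rw [Finset.sum_congr rfl h1, Finset.sum_comm]
  have h2 : ∀ τ ∈ Finset.range (m + 1), ∑ j ∈ Finset.range N,
      u τ / N * omega N ^ ((j : ℤ) * (τ + i - t)) = if (τ : ℤ) = t - i then u τ else 0 := by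
    intro τ hτ
    have hτ' := Finset.mem_range.1 hτ
    rw [← Finset.mul_sum, sum_omega_zpow hN0]
    -- No wrap-around: for these times |τ + i - t| ≤ m + n, which is less than the period.
    have hiff : ((N : ℤ) ∣ τ + i - t) ↔ (τ : ℤ) = t - i := by
      constructor
      · intro hd
        have := Int.eq_zero_of_abs_lt_dvd hd (by rw [abs_lt]; constructor <;> omega)
        omega
      · intro h
        rw [h]; simp
    simp only [hiff]
    split_ifs
    · field_simp
    · simp
  rw [Finset.sum_congr rfl h2]
  split_ifs with hti
  · rw [Finset.sum_eq_single (t - i).toNat]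
    · rw [if_pos (Int.toNat_of_nonneg hti.1), Int.toNat_of_nonneg hti.1]
    · intro b _ hb
      rw [if_neg]
      omega
    · intro h
      rw [Finset.mem_range] at h
      omega
  · refine Finset.sum_eq_zero fun τ hτ => ?_
    have hτ' := Finset.mem_range.1 hτ
    rw [if_neg]
    omega

lemma norm_restr_character (N j : ℕ) : ‖restr m n (character N j)‖ ^ 2 = n + 1 := by
  rw [norm_restr_sq]
  simp_rw [character, norm_omega_zpow]
  simp

/-- The restriction of a character to the window. -/
def windowCharacter (m n j : ℕ) : WindowSpace m n :=
  WithLp.toLp 2 (fun t => character (m + n + 1) j t)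

lemma restr_extend_windowCharacter (j : ℕ) :
    restr m n (extend m n (windowCharacter m n j)) = restr m n (character (m + n + 1) j) := by
  ext t
  rw [restr_extend_apply, restr_apply]
  rfl

/-- Diagonalizing the circulant operator by characters exhibits the convolution as a sum of rank-one
operators, for which traces are explicit. -/
lemma windowConv_eq_sum (u : ℤ → ℂ) (z : WindowSpace m n) :
    windowConv m n u z = ∑ j ∈ Finset.range (m + n + 1),
      (transfer m (m + n + 1) u j / ((m + n + 1 : ℕ) : ℂ) * inner ℂ (windowCharacter m n j) z) •
        restr m n (character (m + n + 1) j) := by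
  ext t
  rw [windowConv_apply, WithLp.ofLp_sum, Finset.sum_apply]
  simp only [PiLp.smul_apply, restr_apply, smul_eq_mul]
  by_cases ht : 0 ≤ (t : ℤ)
  · simp only [ht, true_and, if_true]
    have h1 : ∀ j ∈ Finset.range (m + n + 1), transfer m (m + n + 1) u j / ((m + n + 1 : ℕ) : ℂ) *
        inner ℂ (windowCharacter m n j) z * character (m + n + 1) j t
        = ∑ i : Set.Icc (-(m : ℤ)) (n : ℤ), transfer m (m + n + 1) u j / ((m + n + 1 : ℕ) : ℂ) *
        (omega (m + n + 1) ^ ((j : ℤ) * i) * character (m + n + 1) j t) * z i := by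
      intro j _
      rw [PiLp.inner_apply, Finset.mul_sum, Finset.sum_mul]
      refine Finset.sum_congr rfl fun i _ => ?_
      rw [RCLike.inner_apply, windowCharacter]
      simp only [character]
      rw [conj_omega_zpow, neg_neg]
      ring
    rw [Finset.sum_congr rfl h1, Finset.sum_comm]
    refine Finset.sum_congr rfl fun i _ => ?_
    rw [← Finset.sum_mul, sum_transfer_mul_character u ht t.2.2 i.2.1 i.2.2]
  · simp [ht]

/-- Each rank-one term contributes the pairing of a character with its image under `Q`. The left
factor cuts both characters down to `[0, n]`, which gains (n+1)/(m+n+1) whatever the contraction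
`Q`. -/
lemma norm_trace_windowConv_le (u : ℤ → ℂ) {Q : WindowSpace m n →ₗ[ℂ] WindowSpace m n}
    (hQ : ∀ z, ‖Q z‖ ≤ ‖z‖) :
    ‖LinearMap.trace ℂ _ ((restr m n ∘ₗ extend m n) ∘ₗ Q ∘ₗ windowConv m n u)‖
      ≤ (∑ j ∈ Finset.range (m + n + 1), ‖transfer m (m + n + 1) u j‖)
        * ((n + 1) / (m + n + 1)) := by
  set b := EuclideanSpace.basisFun (Set.Icc (-(m : ℤ)) (n : ℤ)) ℂ with hb
  have htr : LinearMap.trace ℂ _ ((restr m n ∘ₗ extend m n) ∘ₗ Q ∘ₗ windowConv m n u)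
      = ∑ j ∈ Finset.range (m + n + 1), transfer m (m + n + 1) u j / ((m + n + 1 : ℕ) : ℂ) *
        inner ℂ (restr m n (character (m + n + 1) j))
          (Q (restr m n (character (m + n + 1) j))) := by
    rw [LinearMap.trace_eq_sum_inner _ b]
    have h1 : ∀ i, inner ℂ (b i) (((restr m n ∘ₗ extend m n) ∘ₗ Q ∘ₗ windowConv m n u) (b i))
        = ∑ j ∈ Finset.range (m + n + 1), transfer m (m + n + 1) u j / ((m + n + 1 : ℕ) : ℂ) *
          (inner ℂ (windowCharacter m n j) (b i) * inner ℂ (b i)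
            (restr m n (extend m n (Q (restr m n (character (m + n + 1) j)))))) := by
      intro i
      simp only [LinearMap.comp_apply]
      rw [windowConv_eq_sum]
      simp only [map_sum, map_smul, inner_sum, inner_smul_right, mul_assoc]
    simp_rw [h1]
    rw [Finset.sum_comm]
    refine Finset.sum_congr rfl fun j _ => ?_
    rw [← Finset.mul_sum, b.sum_inner_mul_inner, ← inner_restr_extend,
      restr_extend_windowCharacter]
  rw [htr, Finset.sum_mul]
  refine (norm_sum_le _ _).trans (Finset.sum_le_sum fun j _ => ?_)
  rw [norm_mul, norm_div, Complex.norm_natCast]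
  have h2 : ‖inner ℂ (restr m n (character (m + n + 1) j))
      (Q (restr m n (character (m + n + 1) j)))‖ ≤ n + 1 := by
    rw [← norm_restr_character (m := m) (n := n) (m + n + 1) j, sq]
    exact (norm_inner_le_norm _ _).trans (mul_le_mul_of_nonneg_left (hQ _) (norm_nonneg _))
  calc _ ≤ ‖transfer m (m + n + 1) u j‖ / ((m + n + 1 : ℕ) : ℝ) * (n + 1) :=
        mul_le_mul_of_nonneg_left h2 (by positivity)
    _ = _ := by push_cast; ring

/-- The Hilbert-Schmidt norm of a windowed convolution. -/
lemma sum_norm_windowConv_sq_le (u : ℤ → ℂ) {c : ℝ} (hc : 0 ≤ c) (hu : ∀ τ : ℤ, ‖u τ‖ ^ 2 ≤ c) :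
    ∑ i, ‖windowConv m n u (EuclideanSpace.basisFun (Set.Icc (-(m : ℤ)) (n : ℤ)) ℂ i)‖ ^ 2
      ≤ (n + 1) * ((m + 1) * c) := by
  have h1 : ∀ i t, ‖windowConv m n u
      (EuclideanSpace.basisFun (Set.Icc (-(m : ℤ)) (n : ℤ)) ℂ i) t‖ ^ 2
      ≤ if 0 ≤ (t : ℤ) then (if 0 ≤ (t : ℤ) - i ∧ (t : ℤ) - i ≤ m then c else 0) else 0 := by
    intro i t
    rw [windowConv_apply, Finset.sum_eq_single i]
    · rw [EuclideanSpace.basisFun_apply, PiLp.single_apply, if_pos rfl, mul_one]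
      by_cases ht : 0 ≤ (t : ℤ) <;> by_cases hti : 0 ≤ (t : ℤ) - i ∧ (t : ℤ) - i ≤ m
      · rw [if_pos ⟨ht, hti⟩, if_pos ht, if_pos hti]; exact hu _
      · rw [if_neg (fun h => hti h.2), if_neg hti]; simp
      · rw [if_neg (fun h => ht h.1), if_neg ht]; simp
      · rw [if_neg (fun h => ht h.1), if_neg ht]; simp
    · intro k _ hk
      rw [EuclideanSpace.basisFun_apply, PiLp.single_apply, if_neg hk, mul_zero]
    · intro h
      exact absurd (Finset.mem_univ _) h
  -- Each of the `n + 1` active rows has at most `m + 1` nonzero entries.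
  have h2 : ∀ t : Set.Icc (-(m : ℤ)) (n : ℤ), ∑ i : Set.Icc (-(m : ℤ)) (n : ℤ),
      (if 0 ≤ (t : ℤ) - i ∧ (t : ℤ) - i ≤ m then c else 0) ≤ (m + 1) * c := by
    intro t
    rw [← Finset.sum_filter, Finset.sum_const, nsmul_eq_mul]
    refine mul_le_mul_of_nonneg_right ?_ hc
    have : (Finset.univ.filter fun i : Set.Icc (-(m : ℤ)) (n : ℤ) =>
        0 ≤ (t : ℤ) - i ∧ (t : ℤ) - i ≤ m).card ≤ (Finset.range (m + 1)).card := by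
      refine Finset.card_le_card_of_injOn (fun i => ((t : ℤ) - i).toNat) ?_ ?_
      · intro i hi
        have := (Finset.mem_filter.1 (Finset.mem_coe.1 hi)).2
        simp only [Finset.coe_range, Set.mem_Iio]
        omega
      · intro i hi k hk hik
        have h3 := (Finset.mem_filter.1 (Finset.mem_coe.1 hi)).2
        have h4 := (Finset.mem_filter.1 (Finset.mem_coe.1 hk)).2
        simp only at hik
        ext
        omega
    rw [Finset.card_range] at this
    exact_mod_cast this
  calc _ = ∑ i, ∑ t, ‖windowConv m n u
        (EuclideanSpace.basisFun (Set.Icc (-(m : ℤ)) (n : ℤ)) ℂ i) t‖ ^ 2 :=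
        Finset.sum_congr rfl fun i _ => EuclideanSpace.norm_sq_eq _
    _ ≤ ∑ i : Set.Icc (-(m : ℤ)) (n : ℤ), ∑ t : Set.Icc (-(m : ℤ)) (n : ℤ),
        if 0 ≤ (t : ℤ) then (if 0 ≤ (t : ℤ) - i ∧ (t : ℤ) - i ≤ m then c else 0) else 0 :=
        Finset.sum_le_sum fun i _ => Finset.sum_le_sum fun t _ => h1 i t
    _ ≤ ∑ t : Set.Icc (-(m : ℤ)) (n : ℤ), if 0 ≤ (t : ℤ) then (m + 1) * c else 0 := by
        rw [Finset.sum_comm]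
        refine Finset.sum_le_sum fun t _ => ?_
        split_ifs
        · exact h2 t
        · simp
    _ = _ := by
        rw [sum_window (fun _ => (m + 1) * c)]
        simp

end Operators

/-! ### Expansion of feasible filters in Fourier modes. -/

section Modes

variable {m n : ℕ}

/-- The Fourier modes on `[0, m]`, normalized in `ℓ₁`. -/
def mode (m k : ℕ) (τ : ℤ) : ℂ := omega (m + 1) ^ (-((k : ℤ) * τ)) / ((m + 1 : ℕ) : ℂ)

lemma omega_zpow_eq_unitExp (N : ℕ) (k : ℤ) : omega N ^ k = unitExp (k / N) := omega_zpow N k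

lemma unitExp_add (x y : ℝ) : unitExp (x + y) = unitExp x * unitExp y := by
  rw [unitExp, unitExp, unitExp, ← Complex.exp_add]
  congr 1
  push_cast
  ring

lemma norm_mode_sq (k : ℕ) (τ : ℤ) : ‖mode m k τ‖ ^ 2 = (((m : ℝ) + 1) ^ 2)⁻¹ := by
  rw [mode, norm_div, norm_omega_zpow, Complex.norm_natCast]
  push_cast
  rw [one_div, inv_pow]

/-- The transfer function of a mode is a Dirichlet kernel sampled on a grid shifted by -k/(m+1). -/
lemma sum_norm_transfer_mode_le (N k : ℕ) (hN : N ≠ 0) :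
    ∑ j ∈ Finset.range N, ‖transfer m N (mode m k) j‖
      ≤ 2 + N / (m + 1) * (1 + Real.log N) := by
  have h1 : ∀ j ∈ Finset.range N, ‖transfer m N (mode m k) j‖ = ((m : ℝ) + 1)⁻¹ *
      ‖∑ τ ∈ Finset.range (m + 1),
        unitExp (((-(k : ℤ) : ℤ) : ℝ) / ((m + 1 : ℕ) : ℝ) + j / N) ^ τ‖ := by
    intro j _
    have h2 : transfer m N (mode m k) j = (((m + 1 : ℕ) : ℂ))⁻¹ * ∑ τ ∈ Finset.range (m + 1),
        unitExp (((-(k : ℤ) : ℤ) : ℝ) / ((m + 1 : ℕ) : ℝ) + j / N) ^ τ := by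
      rw [transfer, Finset.mul_sum]
      refine Finset.sum_congr rfl fun τ _ => ?_
      have h3 : unitExp ((j : ℝ) / N) = omega N ^ (j : ℤ) := by
        rw [omega_zpow_eq_unitExp, Int.cast_natCast]
      rw [mode, unitExp_add, ← omega_zpow_eq_unitExp, h3, mul_pow, ← zpow_natCast (_ ^ _) τ,
        ← zpow_natCast (_ ^ (j : ℤ)) τ, ← zpow_mul, ← zpow_mul, neg_mul]
      ring
    rw [h2, norm_mul, norm_inv, Complex.norm_natCast]
    push_cast
    rfl
  rw [Finset.sum_congr rfl h1, ← Finset.mul_sum]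
  refine (mul_le_mul_of_nonneg_left (sum_norm_dirichlet_le hN (m + 1) _) (by positivity)).trans
    (le_of_eq ?_)
  push_cast
  field_simp

/-- The Fourier inversion formula. -/
lemma eq_sum_mode (φ : ℤ → ℂ) {τ : ℕ} (hτ : τ ∈ Finset.range (m + 1)) :
    φ τ = ∑ k ∈ Finset.range (m + 1),
      (∑ t ∈ Finset.range (m + 1), φ t * omega (m + 1) ^ ((k : ℤ) * t)) * mode m k τ := by
  have h1 : ∀ k ∈ Finset.range (m + 1),
      (∑ t ∈ Finset.range (m + 1), φ t * omega (m + 1) ^ ((k : ℤ) * t)) * mode m k τ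
      = ∑ t ∈ Finset.range (m + 1),
        φ t / ((m + 1 : ℕ) : ℂ) * omega (m + 1) ^ ((k : ℤ) * ((t : ℤ) - τ)) := by
    intro k _
    rw [Finset.sum_mul]
    refine Finset.sum_congr rfl fun t _ => ?_
    rw [mode, show (k : ℤ) * ((t : ℤ) - τ) = k * t + -(k * τ) by ring,
      zpow_add₀ (omega_ne_zero _)]
    ring
  rw [Finset.sum_congr rfl h1, Finset.sum_comm]
  have h2 : ∀ t ∈ Finset.range (m + 1), ∑ k ∈ Finset.range (m + 1),
      φ t / ((m + 1 : ℕ) : ℂ) * omega (m + 1) ^ ((k : ℤ) * ((t : ℤ) - τ))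
      = if t = τ then φ t else 0 := by
    intro t ht
    rw [← Finset.mul_sum, sum_omega_zpow (Nat.succ_ne_zero m)]
    have hiff : (((m + 1 : ℕ) : ℤ) ∣ (t : ℤ) - τ) ↔ t = τ := by
      have h3 := Finset.mem_range.1 ht
      have h4 := Finset.mem_range.1 hτ
      constructor
      · intro hd
        have := Int.eq_zero_of_abs_lt_dvd hd (by rw [abs_lt]; constructor <;> omega)
        omega
      · rintro rfl; simp
    simp only [hiff]
    have : ((m + 1 : ℕ) : ℂ) ≠ 0 := by exact_mod_cast Nat.succ_ne_zero m
    split_ifs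
    · field_simp
    · simp
  rw [Finset.sum_congr rfl h2, Finset.sum_ite_eq', if_pos hτ]

lemma dft_eq (φ : ℤ → ℂ) (k : ℕ) :
    dft m φ k = ((Real.sqrt ((m : ℝ) + 1))⁻¹ : ℝ) *
      ∑ t ∈ Finset.range (m + 1), φ t * omega (m + 1) ^ ((k : ℤ) * t) := by
  rw [dft]
  congr 1
  refine Finset.sum_congr rfl fun t _ => ?_
  rw [omega_zpow]
  congr 2
  push_cast
  ring

/-- A feasible filter is a combination of Fourier modes with coefficients controlled in `ℓ₁`. -/
lemma exists_coeff_of_mem_feasible {ρ : ℝ} {φ : ℤ → ℂ} (hφ : φ ∈ feasible m ρ) :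
    ∃ a : ℕ → ℂ, ∑ k ∈ Finset.range (m + 1), ‖a k‖ ≤ ρ ∧
      ∀ x, filt m φ x = ∑ k ∈ Finset.range (m + 1), a k • filt m (mode m k) x := by
  -- These coefficients are √(m+1) times the unitary transform, which cancels the 1/√(m+1) in the
  -- feasibility constraint.
  refine ⟨fun k => ∑ t ∈ Finset.range (m + 1), φ t * omega (m + 1) ^ ((k : ℤ) * t), ?_, ?_⟩
  · have h1 := hφ.2
    have hs : 0 < Real.sqrt ((m : ℝ) + 1) := by positivity
    have h2 : fourierL1 m φ = (Real.sqrt ((m : ℝ) + 1))⁻¹ * ∑ k ∈ Finset.range (m + 1),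
        ‖∑ t ∈ Finset.range (m + 1), φ t * omega (m + 1) ^ ((k : ℤ) * t)‖ := by
      rw [fourierL1, Finset.mul_sum]
      refine Finset.sum_congr rfl fun k _ => ?_
      rw [dft_eq, norm_mul, Complex.norm_real, Real.norm_eq_abs, abs_of_pos (inv_pos.2 hs)]
    rw [h2, inv_mul_eq_div] at h1
    exact (div_le_div_iff_of_pos_right hs).1 h1
  · intro x
    funext t
    rw [Finset.sum_apply]
    simp only [Pi.smul_apply, filt_apply, smul_eq_mul, Finset.mul_sum]
    rw [Finset.sum_comm]
    refine Finset.sum_congr rfl fun τ hτ => ?_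
    rw [eq_sum_mode φ hτ, Finset.sum_mul]
    exact Finset.sum_congr rfl fun k _ => by ring

lemma conv_eq_filt {ρ : ℝ} {φ : ℤ → ℂ} (hφ : φ ∈ feasible m ρ) (x : ℤ → ℂ) :
    conv φ x = filt m φ x := by
  funext t
  rw [conv, filt_apply, tsum_eq_sum (s := (Finset.range (m + 1)).map Nat.castEmbedding),
    Finset.sum_map]
  · rfl
  · intro τ hτ
    rw [hφ.1, zero_mul]
    rintro ⟨h1, h2⟩
    refine hτ (Finset.mem_map.2 ⟨τ.toNat, ?_, ?_⟩)
    · rw [Finset.mem_range]; omega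
    · simpa using h1

lemma shift_pow_apply (τ : ℕ) (x : ℤ → ℂ) (t : ℤ) : (shift ^ τ) x t = x (t - τ) := by
  induction τ generalizing t with
  | zero => simp
  | succ τ ih =>
    rw [pow_succ', Module.End.mul_apply]
    change (shift ^ τ) x (t - 1) = _
    rw [ih]
    congr 1
    push_cast
    ring

lemma filt_eq_sum_shift (u x : ℤ → ℂ) :
    filt m u x = ∑ τ ∈ Finset.range (m + 1), u τ • (shift ^ τ) x := by
  funext t
  rw [filt_apply, Finset.sum_apply]
  refine Finset.sum_congr rfl fun τ _ => ?_
  rw [Pi.smul_apply, shift_pow_apply, smul_eq_mul]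

/-- Parseval's identity. -/
lemma sum_norm_sq_mode (v : ℕ → ℂ) :
    ∑ k ∈ Finset.range (m + 1), ‖∑ τ ∈ Finset.range (m + 1), mode m k τ * v τ‖ ^ 2
      = ((m : ℝ) + 1)⁻¹ * ∑ τ ∈ Finset.range (m + 1), ‖v τ‖ ^ 2 := by
  have hM : ((m : ℂ) + 1) ≠ 0 := by exact_mod_cast Nat.succ_ne_zero m
  have h1 : ∀ k ∈ Finset.range (m + 1),
      ((‖∑ τ ∈ Finset.range (m + 1), mode m k τ * v τ‖ ^ 2 : ℝ) : ℂ)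
      = ∑ τ ∈ Finset.range (m + 1), ∑ τ' ∈ Finset.range (m + 1),
        (((m + 1 : ℕ) : ℂ)⁻¹ ^ 2 * (v τ * (starRingEnd ℂ) (v τ'))) *
          omega (m + 1) ^ ((k : ℤ) * ((τ' : ℤ) - τ)) := by
    intro k _
    rw [Complex.ofReal_pow, ← Complex.mul_conj', map_sum, Finset.sum_mul_sum]
    refine Finset.sum_congr rfl fun τ _ => Finset.sum_congr rfl fun τ' _ => ?_
    rw [map_mul, mode, mode, map_div₀, conj_omega_zpow, neg_neg, Complex.conj_natCast,
      show (k : ℤ) * ((τ' : ℤ) - τ) = -(k * τ) + k * τ' by ring, zpow_add₀ (omega_ne_zero _)]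
    ring
  apply Complex.ofReal_injective
  rw [Complex.ofReal_sum, Finset.sum_congr rfl h1, Finset.sum_comm]
  have h2 : ∀ τ ∈ Finset.range (m + 1), ∑ k ∈ Finset.range (m + 1),
      ∑ τ' ∈ Finset.range (m + 1), (((m + 1 : ℕ) : ℂ)⁻¹ ^ 2 * (v τ * (starRingEnd ℂ) (v τ'))) *
          omega (m + 1) ^ ((k : ℤ) * ((τ' : ℤ) - τ))
      = ((m : ℂ) + 1)⁻¹ * ((‖v τ‖ ^ 2 : ℝ) : ℂ) := by
    intro τ hτ
    rw [Finset.sum_comm, Finset.sum_eq_single τ]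
    · rw [← Finset.mul_sum, sub_self]
      simp only [mul_zero, zpow_zero, Finset.sum_const, Finset.card_range, nsmul_eq_mul, mul_one]
      rw [Complex.mul_conj', Complex.ofReal_pow]
      push_cast
      field_simp
    · intro τ' hτ' hne
      rw [← Finset.mul_sum, sum_omega_zpow (Nat.succ_ne_zero m), if_neg, mul_zero]
      intro hd
      have h3 := Finset.mem_range.1 hτ
      have h4 := Finset.mem_range.1 hτ'
      have := Int.eq_zero_of_abs_lt_dvd hd (by rw [abs_lt]; constructor <;> omega)
      omega
    · intro h; exact absurd hτ h
  rw [Finset.sum_congr rfl h2, ← Finset.mul_sum]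
  push_cast
  rfl

/-- The total energy of the responses of a slowly growing sequence to the Fourier modes. -/
lemma sum_norm_restr_filt_mode_sq_le {ε : ℤ → ℂ} {B : ℝ}
    (hε : ∀ τ : ℕ, τ ≤ m → l2norm n ((shift ^ τ) ε) ≤ B) :
    ∑ k ∈ Finset.range (m + 1), ‖restr m n (filt m (mode m k) ε)‖ ^ 2 ≤ B ^ 2 := by
  simp_rw [norm_restr_sq, filt_apply]
  rw [Finset.sum_comm]
  have h1 : ∀ t ∈ Finset.range (n + 1), ∑ k ∈ Finset.range (m + 1),
      ‖∑ τ ∈ Finset.range (m + 1), mode m k τ * ε ((t : ℤ) - τ)‖ ^ 2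
      = ((m : ℝ) + 1)⁻¹ * ∑ τ ∈ Finset.range (m + 1), ‖ε ((t : ℤ) - τ)‖ ^ 2 := fun t _ =>
    sum_norm_sq_mode fun τ => ε ((t : ℤ) - τ)
  rw [Finset.sum_congr rfl h1, ← Finset.mul_sum, Finset.sum_comm]
  have h2 : ∀ τ ∈ Finset.range (m + 1), ∑ t ∈ Finset.range (n + 1), ‖ε ((t : ℤ) - τ)‖ ^ 2
      ≤ B ^ 2 := by
    intro τ hτ
    have h3 := hε τ (by have := Finset.mem_range.1 hτ; omega)
    rw [← norm_restr (m := m)] at h3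
    have h4 := pow_le_pow_left₀ (norm_nonneg _) h3 2
    rw [norm_restr_sq] at h4
    simpa only [shift_pow_apply] using h4
  -- The Parseval factor 1/(m+1) turns the sum over `m + 1` shifts into an average.
  refine (mul_le_mul_of_nonneg_left (Finset.sum_le_sum h2) (by positivity)).trans (le_of_eq ?_)
  rw [Finset.sum_const, Finset.card_range, nsmul_eq_mul]
  push_cast
  field_simp

end Modes

/-! ### The favourable noise event and its probability. -/

section NoiseEvent

variable {m n : ℕ}

/-- Source of the constant 55 in `vAlpha`: e⁴ < 55, and the tail bound for sesquilinear forms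
requires t ≥ 4. -/
lemma four_le_log : (4 : ℝ) ≤ Real.log 55 := by
  rw [Real.le_log_iff_exp_le (by norm_num)]
  have h := Real.exp_one_lt_d9
  have h1 : Real.exp 4 = Real.exp 1 ^ 4 := by rw [← Real.exp_nat_mul]; norm_num
  rw [h1]
  calc Real.exp 1 ^ 4 ≤ 2.7182818286 ^ 4 := pow_le_pow_left₀ (Real.exp_nonneg _) h.le 4
    _ ≤ 55 := by norm_num

lemma log_vAlpha_eq (m n : ℕ) {α : ℝ} (hα : 0 < α) :
    Real.log (55 * ((m : ℝ) + n + 1) / α)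
      = Real.log 55 + Real.log ((m : ℝ) + n + 1) - Real.log α := by
  rw [Real.log_div (by positivity) hα.ne', Real.log_mul (by norm_num) (by positivity)]

lemma log_window_add_four_le (m n : ℕ) {α : ℝ} (hα : 0 < α) (hα1 : α ≤ 1) :
    Real.log ((m : ℝ) + n + 1) + 4 ≤ Real.log (55 * ((m : ℝ) + n + 1) / α) := by
  rw [log_vAlpha_eq m n hα]
  linarith [four_le_log, Real.log_nonpos hα.le hα1]

lemma kappa_pos (m n : ℕ) : 0 < kappa m n := by
  rw [kappa]; positivity

lemma kappa_sq (m n : ℕ) : kappa m n ^ 2 = ((n : ℝ) + 1) / (m + 1) := by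
  rw [kappa, Real.sq_sqrt (by positivity)]

lemma cAlpha_sq {α : ℝ} (hα : 0 < α) (hα1 : α ≤ 1) : cAlpha α ^ 2 = 2 * Real.log (16 / α) := by
  rw [cAlpha, Real.sq_sqrt]
  have : 0 ≤ Real.log (16 / α) := Real.log_nonneg (by rw [le_div_iff₀ hα]; linarith)
  linarith

lemma one_le_log_sixteen_div {α : ℝ} (hα : 0 < α) (hα1 : α ≤ 1) : 1 ≤ Real.log (16 / α) := by
  rw [Real.le_log_iff_exp_le (by positivity), le_div_iff₀ hα]
  nlinarith [Real.exp_one_lt_d9, Real.exp_pos 1]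

lemma cAlpha_nonneg (α : ℝ) : 0 ≤ cAlpha α := Real.sqrt_nonneg _

/-- The quadratic forms of the noise which arise from the Fourier modes are bounded by `V_α`. -/
lemma quadratic_mode_tail {α : ℝ} (hα : 0 < α) (hα1 : α ≤ 1)
    {Q : WindowSpace m n →ₗ[ℂ] WindowSpace m n} (hQ : ∀ z, ‖Q z‖ ≤ ‖z‖) (k : ℕ) :
    stdGaussian (WindowSpace m n) {z | vAlpha m n α < ‖inner ℂ z
        (((restr m n ∘ₗ extend m n) ∘ₗ Q ∘ₗ windowConv m n (mode m k)) z)‖}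
      ≤ ENNReal.ofReal (4 * (α / (55 * ((m : ℝ) + n + 1)))) := by
  set K := (restr m n ∘ₗ extend m n) ∘ₗ Q ∘ₗ windowConv m n (mode m k) with hK
  set L := Real.log (55 * ((m : ℝ) + n + 1) / α) with hL
  have hL4 := log_window_add_four_le m n hα hα1
  rw [← hL] at hL4
  have hlog0 : 0 ≤ Real.log ((m : ℝ) + n + 1) := Real.log_nonneg (by
    have : (0 : ℝ) ≤ m := Nat.cast_nonneg m
    have : (0 : ℝ) ≤ n := Nat.cast_nonneg n
    linarith)
  have hκ := kappa_pos m n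
  have hHS : ∑ i, ‖K (EuclideanSpace.basisFun (Set.Icc (-(m : ℤ)) (n : ℤ)) ℂ i)‖ ^ 2
      ≤ kappa m n ^ 2 := by
    have h1 := sum_norm_windowConv_sq_le (m := m) (n := n) (mode m k)
      (c := (((m : ℝ) + 1) ^ 2)⁻¹) (by positivity) (fun τ => (norm_mode_sq k τ).le)
    refine (Finset.sum_le_sum fun i _ => ?_).trans (h1.trans (le_of_eq ?_))
    · exact pow_le_pow_left₀ (norm_nonneg _) ((norm_restr_extend_le _).trans (hQ _)) 2
    · rw [kappa_sq]; field_simp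
  have htr : ‖LinearMap.trace ℂ _ K‖ ≤ 2 + kappa m n ^ 2 * L := by
    refine (norm_trace_windowConv_le (mode m k) hQ).trans ?_
    have h1 := sum_norm_transfer_mode_le (m := m) (m + n + 1) k (by omega)
    push_cast at h1
    have h2 : ((n : ℝ) + 1) / (m + n + 1) ≤ 1 := by
      rw [div_le_one (by positivity)]
      have : (0 : ℝ) ≤ m := Nat.cast_nonneg m
      linarith
    calc _ ≤ (2 + ((m : ℝ) + n + 1) / (m + 1) * (1 + Real.log ((m : ℝ) + n + 1)))
            * ((n + 1) / (m + n + 1)) := mul_le_mul_of_nonneg_right h1 (by positivity)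
      _ = 2 * (((n : ℝ) + 1) / (m + n + 1))
          + kappa m n ^ 2 * (1 + Real.log ((m : ℝ) + n + 1)) := by
          rw [kappa_sq]; field_simp
      _ ≤ 2 * 1 + kappa m n ^ 2 * L := by
          gcongr
          linarith
      _ = _ := by ring
  have htail := norm_inner_apply_tail K (EuclideanSpace.basisFun _ ℂ)
    (v := kappa m n ^ 2) (t := L) (by positivity) (by linarith) hHS
  rw [Real.sqrt_sq hκ.le] at htail
  have hexp : Real.exp (-L) = α / (55 * ((m : ℝ) + n + 1)) := by
    rw [Real.exp_neg, hL, Real.exp_log (by positivity), inv_div]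
  rw [hexp] at htail
  refine (measure_mono fun z hz => ?_).trans htail
  simp only [Set.mem_ofPred_eq] at hz ⊢
  refine lt_of_le_of_lt ?_ hz
  rw [vAlpha, ← hL]
  have hL0 : 0 ≤ L := by linarith
  -- Here 2(2 + κ²L) + 8κL ≤ 2L(1 + 4κ)², the constant 4 being absorbed by 2L since L ≥ 4.
  nlinarith [mul_nonneg hκ.le hL0, mul_nonneg (sq_nonneg (kappa m n)) hL0]

/-- The norm of the projection of a standard Gaussian vector onto a subspace of dimension at most
`s`. -/
lemma norm_starProjection_tail {ι : Type*} [Fintype ι] (W : Submodule ℂ (EuclideanSpace ℂ ι))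
    {s : ℕ} (hs : 1 ≤ s) (hW : Module.finrank ℂ W ≤ s) {t : ℝ} (ht : 0 ≤ t) :
    stdGaussian (EuclideanSpace ℂ ι)
      {z | Real.sqrt (2 * s) + Real.sqrt (2 * t) < ‖W.starProjection z‖}
      ≤ ENNReal.ofReal (Real.exp (-t)) := by
  set T : EuclideanSpace ℂ ι →ₗ[ℂ] EuclideanSpace ℂ ι := W.starProjection.toLinearMap with hT
  have hsym : T.IsSymmetric := W.starProjection_isSymmetric
  have hsq : ∀ z, (inner ℂ z (T z)).re = ‖T z‖ ^ 2 := by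
    intro z
    have h1 : T (T z) = T z :=
      Submodule.starProjection_eq_self_iff.2 (W.starProjection_apply_mem z)
    have h2 : inner ℂ z (T z) = inner ℂ (T z) (T z) := by rw [hsym, h1]
    rw [h2, inner_self_eq_norm_sq_to_K]
    norm_cast
  have htr : LinearMap.trace ℂ _ T = (Module.finrank ℂ W : ℂ) :=
    LinearMap.IsProj.trace ⟨fun z => W.starProjection_apply_mem z,
      fun z hz => Submodule.starProjection_eq_self_iff.2 hz⟩
  have hs0 : (0 : ℝ) < s := by exact_mod_cast hs
  have hWs : (Module.finrank ℂ W : ℝ) ≤ s := by exact_mod_cast hW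
  -- For an orthogonal projection the squared Hilbert-Schmidt norm is the trace. It is bounded by
  -- `s` rather than kept as the dimension, which may be zero while `v` must be positive.
  have hHS : ∑ i, ‖T (EuclideanSpace.basisFun ι ℂ i)‖ ^ 2 ≤ s := by
    have h1 : (LinearMap.trace ℂ _ T).re = ∑ i, ‖T (EuclideanSpace.basisFun ι ℂ i)‖ ^ 2 := by
      rw [LinearMap.trace_eq_sum_inner T (EuclideanSpace.basisFun ι ℂ), Complex.re_sum]
      exact Finset.sum_congr rfl fun i _ => hsq _
    rw [← h1, htr, Complex.natCast_re]
    exact hWs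
  have hop : ∀ z, (inner ℂ z (T z)).re ≤ 1 * ‖z‖ ^ 2 := by
    intro z
    rw [hsq, one_mul]
    exact pow_le_pow_left₀ (norm_nonneg _) (W.norm_starProjection_apply_le z) 2
  refine (measure_mono fun z hz => ?_).trans
    (quadraticForm_tail hsym _ hs0 zero_le_one ht hHS hop)
  simp only [Set.mem_ofPred_eq] at hz ⊢
  rw [hsq, htr, Complex.natCast_re]
  have h1 := pow_le_pow_left₀ (by positivity) hz.le 2
  -- The deviation bound 2s + 4√(st) + 2t is a perfect square.
  have h2 : Real.sqrt (2 * s) * Real.sqrt (2 * t) = 2 * Real.sqrt (s * t) := by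
    rw [← Real.sqrt_mul (by positivity), show (2 * (s : ℝ)) * (2 * t) = 2 ^ 2 * (s * t) by ring,
      Real.sqrt_mul (by positivity), Real.sqrt_sq (by norm_num)]
  rw [add_sq, mul_assoc, h2, Real.sq_sqrt (by positivity), Real.sq_sqrt (by positivity)] at h1
  have h3 : ‖W.starProjection z‖ = ‖T z‖ := rfl
  rw [h3] at h1
  linarith

/-- The noise vectors for which the bounds on the quadratic, on the low-dimensional and on the
linear terms hold. -/
def noiseEvent (m n s : ℕ) (B α : ℝ) (W : Submodule ℂ (WindowSpace m n)) (ε : ℤ → ℂ) :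
    Set (WindowSpace m n) :=
  {z | (∀ k ∈ Finset.range (m + 1), ‖inner ℂ z (((restr m n ∘ₗ extend m n) ∘ₗ
      Wᗮ.starProjection.toLinearMap ∘ₗ windowConv m n (mode m k)) z)‖ ≤ vAlpha m n α) ∧
    ‖W.starProjection z‖ ≤ Real.sqrt (2 * s) + cAlpha α ∧
    ∀ k ∈ Finset.range (m + 1), ‖inner ℂ ((restr m n ∘ₗ extend m n)
      (Wᗮ.starProjection (restr m n (filt m (mode m k) ε)))) z‖ ≤ B * cAlpha α}

lemma measurableSet_noiseEvent (s : ℕ) (B α : ℝ) (W : Submodule ℂ (WindowSpace m n)) (ε : ℤ → ℂ) :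
    MeasurableSet (noiseEvent m n s B α W ε) := by
  have hcont : ∀ K : WindowSpace m n →ₗ[ℂ] WindowSpace m n, Continuous K := fun K =>
    K.continuous_of_finiteDimensional
  have h1 : ∀ (K : WindowSpace m n →ₗ[ℂ] WindowSpace m n) (c : ℝ),
      MeasurableSet {z | ‖inner ℂ z (K z)‖ ≤ c} := fun K c =>
    (isClosed_le (Continuous.norm (Continuous.inner (𝕜 := ℂ) continuous_id (hcont K)))
      continuous_const).measurableSet
  have h2 : ∀ (c : ℝ), MeasurableSet {z | ‖W.starProjection z‖ ≤ c} := fun c =>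
    (isClosed_le W.starProjection.continuous.norm continuous_const).measurableSet
  have h3 : ∀ (a : WindowSpace m n) (c : ℝ), MeasurableSet {z | ‖inner ℂ a z‖ ≤ c} := fun a c =>
    (isClosed_le (Continuous.norm (Continuous.inner (𝕜 := ℂ) continuous_const continuous_id))
      continuous_const).measurableSet
  have heq := (Finset.measurableSet_biInter (Finset.range (m + 1)) fun k _ =>
    h1 ((restr m n ∘ₗ extend m n) ∘ₗ Wᗮ.starProjection.toLinearMap ∘ₗ windowConv m n (mode m k))
      (vAlpha m n α)).inter ((h2 (Real.sqrt (2 * s) + cAlpha α)).inter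
    (Finset.measurableSet_biInter (Finset.range (m + 1)) fun k _ =>
    h3 ((restr m n ∘ₗ extend m n) (Wᗮ.starProjection (restr m n (filt m (mode m k) ε))))
      (B * cAlpha α)))
  convert heq using 1
  ext z
  simp only [noiseEvent, Set.mem_inter_iff, Set.mem_iInter, Set.mem_ofPred_eq]

/-- The failure probabilities are at most α/13 for the quadratic forms (from 4(m+1)/(55(m+n+1)) ≤
4/55) and α/16 for each of the other two families. -/
lemma stdGaussian_noiseEvent_ge {s : ℕ} (hs : 1 ≤ s) {B α : ℝ} (hB : 0 ≤ B) (hα : 0 < α)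
    (hα1 : α ≤ 1) (W : Submodule ℂ (WindowSpace m n)) (hW : Module.finrank ℂ W ≤ s) {ε : ℤ → ℂ}
    (hε : ∀ τ : ℕ, τ ≤ m → l2norm n ((shift ^ τ) ε) ≤ B) :
    ENNReal.ofReal (1 - α) ≤ stdGaussian (WindowSpace m n) (noiseEvent m n s B α W ε) := by
  set ν := stdGaussian (WindowSpace m n)
  set t := Real.log (16 / α) with ht
  have ht1 : 1 ≤ t := one_le_log_sixteen_div hα hα1
  have hexp : Real.exp (-t) = α / 16 := by
    rw [Real.exp_neg, ht, Real.exp_log (by positivity), inv_div]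
  have hc : cAlpha α = Real.sqrt (2 * t) := rfl
  have hQ : ∀ z, ‖Wᗮ.starProjection.toLinearMap z‖ ≤ ‖z‖ := fun z =>
    Wᗮ.norm_starProjection_apply_le z
  have h1 : ν (⋃ k ∈ Finset.range (m + 1), {z | vAlpha m n α < ‖inner ℂ z
      (((restr m n ∘ₗ extend m n) ∘ₗ Wᗮ.starProjection.toLinearMap ∘ₗ
        windowConv m n (mode m k)) z)‖}) ≤ ENNReal.ofReal (α / 13) := by
    refine (measure_biUnion_finset_le _ _).trans ((Finset.sum_le_sum fun k _ =>
      quadratic_mode_tail hα hα1 hQ k).trans ?_)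
    rw [Finset.sum_const, Finset.card_range, nsmul_eq_mul, ← ENNReal.ofReal_natCast,
      ← ENNReal.ofReal_mul (by positivity)]
    refine ENNReal.ofReal_le_ofReal ?_
    have hm : (0 : ℝ) ≤ m := Nat.cast_nonneg m
    have hn : (0 : ℝ) ≤ n := Nat.cast_nonneg n
    push_cast
    rw [show ((m : ℝ) + 1) * (4 * (α / (55 * ((m : ℝ) + n + 1))))
      = (4 * α * (m + 1)) / (55 * ((m : ℝ) + n + 1)) by ring, div_le_div_iff₀ (by positivity)
      (by norm_num)]
    nlinarith [mul_nonneg hα.le hm, mul_nonneg hα.le hn]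
  have h2 : ν {z | Real.sqrt (2 * s) + cAlpha α < ‖W.starProjection z‖}
      ≤ ENNReal.ofReal (α / 16) := by
    rw [hc, ← hexp]
    exact norm_starProjection_tail W hs hW (by linarith)
  have h3 : ν {z | ∃ k ∈ Finset.range (m + 1), B * cAlpha α < ‖inner ℂ ((restr m n ∘ₗ extend m n)
      (Wᗮ.starProjection (restr m n (filt m (mode m k) ε)))) z‖} ≤ ENNReal.ofReal (α / 16) := by
    rw [hc, ← hexp]
    refine exists_norm_inner_tail _ _ hB ht1 ((Finset.sum_le_sum fun k _ => ?_).trans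
      (sum_norm_restr_filt_mode_sq_le hε))
    exact pow_le_pow_left₀ (norm_nonneg _) ((norm_restr_extend_le _).trans (hQ _)) 2
  have hsub : (noiseEvent m n s B α W ε)ᶜ ⊆
      ((⋃ k ∈ Finset.range (m + 1), {z | vAlpha m n α < ‖inner ℂ z
      (((restr m n ∘ₗ extend m n) ∘ₗ Wᗮ.starProjection.toLinearMap ∘ₗ
        windowConv m n (mode m k)) z)‖}) ∪
      {z | Real.sqrt (2 * s) + cAlpha α < ‖W.starProjection z‖}) ∪
      {z | ∃ k ∈ Finset.range (m + 1), B * cAlpha α < ‖inner ℂ ((restr m n ∘ₗ extend m n)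
      (Wᗮ.starProjection (restr m n (filt m (mode m k) ε)))) z‖} := by
    intro z hz
    by_contra hcon
    simp only [Set.mem_union, Set.mem_iUnion, Set.mem_ofPred_eq, not_or, not_exists, not_and,
      not_lt, exists_prop] at hcon
    exact hz ⟨hcon.1.1, hcon.1.2, hcon.2⟩
  have hcompl : ν (noiseEvent m n s B α W ε)ᶜ ≤ ENNReal.ofReal α := by
    refine (measure_mono hsub).trans ((measure_union_le _ _).trans
      ((add_le_add ((measure_union_le _ _).trans (add_le_add h1 h2)) h3).trans ?_))
    rw [← ENNReal.ofReal_add (by positivity) (by positivity),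
      ← ENNReal.ofReal_add (by positivity) (by positivity)]
    exact ENNReal.ofReal_le_ofReal (by linarith)
  have hms := measurableSet_noiseEvent (m := m) (n := n) s B α W ε
  rw [prob_compl_eq_one_sub hms] at hcompl
  rw [ENNReal.ofReal_sub _ hα.le, ENNReal.ofReal_one]
  exact tsub_le_iff_tsub_le.1 hcompl

end NoiseEvent

/-! ### Error analysis on the noise event. -/

section Deterministic

variable {m n : ℕ}

/-- The restriction of a sequence to the window. -/
def windowVec (m n : ℕ) (z : ℤ → ℂ) : WindowSpace m n := WithLp.toLp 2 (fun t => z t)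

lemma restr_extend_windowVec (z : ℤ → ℂ) :
    restr m n (extend m n (windowVec m n z)) = restr m n z := by
  ext t
  rw [restr_extend_apply, restr_apply]
  rfl

lemma windowConv_windowVec (u z : ℤ → ℂ) :
    windowConv m n u (windowVec m n z) = restr m n (filt m u z) := by
  ext t
  change restr m n (filt m u (extend m n (windowVec m n z))) t = _
  rw [restr_apply, restr_apply]
  split_ifs with ht
  · rw [filt_apply, filt_apply]
    refine Finset.sum_congr rfl fun τ hτ => ?_
    have hmem : (t : ℤ) - τ ∈ Set.Icc (-(m : ℤ)) (n : ℤ) := by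
      have := Finset.mem_range.1 hτ
      have := t.2.1
      have := t.2.2
      exact ⟨by omega, by omega⟩
    rw [extend_apply _ hmem]
    rfl
  · rfl

lemma restr_extend_of_mem_map {S : Submodule ℂ (ℤ → ℂ)} {w : WindowSpace m n}
    (hw : w ∈ S.map (restr m n)) : restr m n (extend m n w) = w := by
  obtain ⟨x, -, rfl⟩ := hw
  ext t
  rw [restr_extend_apply, restr_apply]
  split_ifs <;> rfl

/-- Vectors of the image of `S` vanish at negative times, so its projection does not see the noise
there. The event can therefore be stated for the full window vector, whose law is standard. -/
lemma starProjection_restr_extend (S : Submodule ℂ (ℤ → ℂ)) (z : WindowSpace m n) :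
    (S.map (restr m n)).starProjection (restr m n (extend m n z))
      = (S.map (restr m n)).starProjection z := by
  refine ext_inner_right ℂ fun y => ?_
  rw [Submodule.inner_starProjection_left_eq_right, Submodule.inner_starProjection_left_eq_right,
    inner_restr_extend, restr_extend_of_mem_map (Submodule.starProjection_apply_mem _ _)]

lemma filt_mem {S : Submodule ℂ (ℤ → ℂ)} (hS : ∀ u ∈ S, shift u ∈ S) (u : ℤ → ℂ) {x : ℤ → ℂ}
    (hx : x ∈ S) : filt m u x ∈ S := by
  have hpow : ∀ τ : ℕ, (shift ^ τ) x ∈ S := by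
    intro τ
    induction τ with
    | zero => simpa using hx
    | succ τ ih => rw [pow_succ', Module.End.mul_apply]; exact hS _ ih
  rw [filt_eq_sum_shift]
  exact S.sum_mem fun τ _ => S.smul_mem _ (hpow τ)

lemma filt_observe (u x : ℤ → ℂ) (σ : ℝ) (z : ℤ → ℂ) :
    filt m u (observe x σ z) = filt m u x + (σ : ℂ) • filt m u z := by
  have : observe x σ z = x + (σ : ℂ) • z := rfl
  rw [this, map_add, map_smul]

/-- On the noise event, the linear and quadratic error terms of all feasible filters are
controlled. -/
lemma noiseEvent_bounds {s : ℕ} {B α ρ : ℝ} {W : Submodule ℂ (WindowSpace m n)} {ε z φ : ℤ → ℂ}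
    (hz : windowVec m n z ∈ noiseEvent m n s B α W ε) (hB : 0 ≤ B) (hV : 0 ≤ vAlpha m n α)
    (hφ : φ ∈ feasible m ρ) :
    ‖inner ℂ (Wᗮ.starProjection (restr m n z)) (restr m n (filt m φ z))‖ ≤ ρ * vAlpha m n α ∧
    ‖inner ℂ (Wᗮ.starProjection (restr m n z)) (restr m n (filt m φ ε))‖
      ≤ ρ * (B * cAlpha α) := by
  obtain ⟨a, ha, hdec⟩ := exists_coeff_of_mem_feasible hφ
  have hc := cAlpha_nonneg α
  have key : ∀ (x : ℤ → ℂ) (c : ℝ), 0 ≤ c → (∀ k ∈ Finset.range (m + 1),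
      ‖inner ℂ (Wᗮ.starProjection (restr m n z)) (restr m n (filt m (mode m k) x))‖ ≤ c) →
      ‖inner ℂ (Wᗮ.starProjection (restr m n z)) (restr m n (filt m φ x))‖ ≤ ρ * c := by
    intro x c hc h
    rw [hdec, map_sum, inner_sum]
    calc _ ≤ ∑ k ∈ Finset.range (m + 1), ‖a k‖ * c := by
          refine (norm_sum_le _ _).trans (Finset.sum_le_sum fun k hk => ?_)
          rw [map_smul, inner_smul_right, norm_mul]
          exact mul_le_mul_of_nonneg_left (h k hk) (norm_nonneg _)
      _ ≤ ρ * c := by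
          rw [← Finset.sum_mul]
          exact mul_le_mul_of_nonneg_right ha hc
  constructor
  · refine key z _ hV fun k hk => ?_
    refine le_trans (le_of_eq ?_) (hz.1 k hk)
    congr 1
    rw [Submodule.inner_starProjection_left_eq_right, ← restr_extend_windowVec z,
      inner_restr_extend, ← windowConv_windowVec]
    rfl
  · refine key ε _ (mul_nonneg hB hc) fun k hk => ?_
    refine le_trans (le_of_eq ?_) (hz.2.2 k hk)
    rw [Submodule.inner_starProjection_left_eq_right, ← restr_extend_windowVec z,
      inner_restr_extend, norm_inner_symm]
    rfl

/-- Completing the square: (r - σb)² ≤ (q + σb)² + 4σ²(p² + d²), and the right side is at most (q +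
σb + 2σ(p + d))². -/
lemma le_of_sq_le_add {r q σ b p d : ℝ} (hσ : 0 ≤ σ) (hq : 0 ≤ q) (hb : 0 ≤ b) (hp : 0 ≤ p)
    (hd : 0 ≤ d) (h : r ^ 2 ≤ q ^ 2 + 2 * σ * (b * (r + q) + 2 * σ * (p ^ 2 + d ^ 2))) :
    r ≤ q + 2 * σ * (p + d + b) := by
  have h1 : (r - σ * b) ^ 2 ≤ (q + σ * b + 2 * σ * (p + d)) ^ 2 := by
    have h2 : 0 ≤ σ ^ 2 * (p * d) := by positivity
    have h3 : 0 ≤ σ * (p + d) * (q + σ * b) := by positivity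
    nlinarith
  have h4 := (abs_le_of_sq_le_sq' h1 (by positivity)).2
  linarith

/-- The deterministic part of the analysis of the constrained least-squares estimator. -/
lemma l2norm_sub_conv_le {s : ℕ} {ρ σ ϰ α : ℝ} {x xS ε z φ φhat : ℤ → ℂ}
    {S : Submodule ℂ (ℤ → ℂ)} (hρ : 1 ≤ ρ) (hσ : 0 ≤ σ) (hϰ : 0 ≤ ϰ) (hV : 0 ≤ vAlpha m n α)
    (hS : ∀ u ∈ S, shift u ∈ S) (hxS : xS ∈ S) (hx : x = xS + ε)
    (hz : windowVec m n z ∈ noiseEvent m n s (σ * ϰ) α (S.map (restr m n)) ε)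
    (hφ : φ ∈ feasible m ρ) (hhat : IsConstrainedLS m n ρ (observe x σ z) φhat) :
    l2norm n (x - conv φhat (observe x σ z)) ≤ l2norm n (x - conv φ (observe x σ z)) +
      2 * σ * (Real.sqrt (ρ * vAlpha m n α) + Real.sqrt ((ρ + 1) * cAlpha α * ϰ)
        + Real.sqrt (2 * s) + cAlpha α) := by
  set W := S.map (restr m n) with hW
  set y := observe x σ z with hy
  set Z := restr m n z with hZ
  set b := Real.sqrt (2 * s) + cAlpha α with hb
  have hc := cAlpha_nonneg α
  have hZW : ‖W.starProjection Z‖ ≤ b := by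
    rw [hZ, ← restr_extend_windowVec, hW, starProjection_restr_extend]
    exact hz.2.1
  have hinner : ∀ ψ ∈ feasible m ρ, inner ℂ Z (restr m n (x - conv ψ y))
      = inner ℂ (W.starProjection Z) (restr m n (x - conv ψ y))
        + inner ℂ (Wᗮ.starProjection Z) (restr m n ε)
        - inner ℂ (Wᗮ.starProjection Z) (restr m n (filt m ψ ε))
        - σ * inner ℂ (Wᗮ.starProjection Z) (restr m n (filt m ψ z)) := by
    intro ψ hψ
    have h1 : restr m n (x - conv ψ y) = restr m n (xS - filt m ψ xS) + (restr m n ε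
        - restr m n (filt m ψ ε) - (σ : ℂ) • restr m n (filt m ψ z)) := by
      rw [conv_eq_filt hψ, hy, filt_observe, hx]
      simp only [map_add, map_sub, map_smul]
      abel
    -- Shift-invariance enters here: xS - ψ*xS stays in `S`, so its restriction is orthogonal to
    -- `Wᗮ`.
    have h2 : inner ℂ (Wᗮ.starProjection Z) (restr m n (xS - filt m ψ xS)) = 0 :=
      Submodule.inner_left_of_mem_orthogonal
        (Submodule.mem_map_of_mem (S.sub_mem hxS (filt_mem hS ψ hxS)))
        (Wᗮ.starProjection_apply_mem Z)
    have h3 : inner ℂ Z (restr m n (x - conv ψ y))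
        = inner ℂ (W.starProjection Z) (restr m n (x - conv ψ y))
        + inner ℂ (Wᗮ.starProjection Z) (restr m n (x - conv ψ y)) := by
      rw [← inner_add_left, Submodule.starProjection_add_starProjection_orthogonal]
    have h4 : inner ℂ (Wᗮ.starProjection Z) (restr m n (x - conv ψ y))
        = inner ℂ (Wᗮ.starProjection Z) (restr m n ε)
        - inner ℂ (Wᗮ.starProjection Z) (restr m n (filt m ψ ε))
        - σ * inner ℂ (Wᗮ.starProjection Z) (restr m n (filt m ψ z)) := by
      rw [h1, inner_add_right, h2, zero_add, inner_sub_right, inner_sub_right, inner_smul_right]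
    rw [h3, h4]
    ring
  have hls := hhat.2 φ hφ
  have hsplit : ∀ ψ, l2norm n (y - conv ψ y) ^ 2 = l2norm n (x - conv ψ y) ^ 2
      + 2 * σ * (inner ℂ Z (restr m n (x - conv ψ y))).re + σ ^ 2 * ‖Z‖ ^ 2 := by
    intro ψ
    have h1 : restr m n (y - conv ψ y) = restr m n (x - conv ψ y) + (σ : ℂ) • Z := by
      rw [hZ, ← map_smul, ← map_add]
      congr 1
      have : y = x + (σ : ℂ) • z := rfl
      nth_rewrite 1 [this]
      abel
    have h2 : (inner ℂ (restr m n (x - conv ψ y)) Z).re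
        = (inner ℂ Z (restr m n (x - conv ψ y))).re :=
      inner_re_symm (𝕜 := ℂ) _ _
    rw [← norm_restr (m := m), ← norm_restr (m := m), h1, norm_add_sq (𝕜 := ℂ), inner_smul_right,
      norm_smul, mul_pow, Complex.norm_real, Real.norm_eq_abs, sq_abs, RCLike.re_to_complex,
      Complex.re_ofReal_mul, h2]
    ring
  rw [hsplit, hsplit, hinner φhat hhat.1, hinner φ hφ] at hls
  have hproj : ∀ ψ, |(inner ℂ (W.starProjection Z) (restr m n (x - conv ψ y))).re|
      ≤ b * l2norm n (x - conv ψ y) := by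
    intro ψ
    rw [← norm_restr (m := m)]
    exact (Complex.abs_re_le_norm _).trans ((norm_inner_le_norm _ _).trans
      (mul_le_mul_of_nonneg_right hZW (norm_nonneg _)))
  obtain ⟨q1, l1⟩ := noiseEvent_bounds hz (mul_nonneg hσ hϰ) hV hφ
  obtain ⟨q2, l2⟩ := noiseEvent_bounds hz (mul_nonneg hσ hϰ) hV hhat.1
  have q1' := abs_le.1 ((Complex.abs_re_le_norm _).trans q1)
  have l1' := abs_le.1 ((Complex.abs_re_le_norm _).trans l1)
  have q2' := abs_le.1 ((Complex.abs_re_le_norm _).trans q2)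
  have l2' := abs_le.1 ((Complex.abs_re_le_norm _).trans l2)
  have p1 := abs_le.1 (hproj φ)
  have p2 := abs_le.1 (hproj φhat)
  have hmain := le_of_sq_le_add (r := l2norm n (x - conv φhat y)) (q := l2norm n (x - conv φ y))
    (σ := σ) (b := b) (p := Real.sqrt (ρ * vAlpha m n α))
    (d := Real.sqrt ((ρ + 1) * cAlpha α * ϰ)) hσ (Real.sqrt_nonneg _) (by positivity)
    (Real.sqrt_nonneg _) (Real.sqrt_nonneg _) ?_
  · refine hmain.trans (le_of_eq ?_)
    rw [hb]; ring
  · rw [Real.sq_sqrt (by positivity), Real.sq_sqrt (by positivity)]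
    simp only [Complex.add_re, Complex.sub_re, Complex.re_ofReal_mul] at hls
    set R := l2norm n (x - conv φhat y)
    set R0 := l2norm n (x - conv φ y)
    set e0 := (inner ℂ ((Wᗮ).starProjection Z) (restr m n ε)).re
    have hcross : 0 ≤ σ * (cAlpha α * ϰ) := by positivity
    -- The common term `e0` cancels. The filtered ε terms total at most 2σρ c_α ϰ, so the factor `ρ
    -- + 1` leaves some slack.
    have hdiff : (inner ℂ (W.starProjection Z) (restr m n (x - conv φ y))).re + e0
        - (inner ℂ (Wᗮ.starProjection Z) (restr m n (filt m φ ε))).re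
        - σ * (inner ℂ (Wᗮ.starProjection Z) (restr m n (filt m φ z))).re
        - ((inner ℂ (W.starProjection Z) (restr m n (x - conv φhat y))).re + e0
        - (inner ℂ (Wᗮ.starProjection Z) (restr m n (filt m φhat ε))).re
        - σ * (inner ℂ (Wᗮ.starProjection Z) (restr m n (filt m φhat z))).re)
        ≤ b * (R + R0) + 2 * σ * (ρ * vAlpha m n α + (ρ + 1) * cAlpha α * ϰ) := by
      have t1 := mul_le_mul_of_nonneg_left q1'.1 hσ
      have t2 := mul_le_mul_of_nonneg_left q2'.2 hσ
      nlinarith [p1.1, p1.2, p2.1, p2.2, l1'.1, l1'.2, l2'.1, l2'.2]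
    have := mul_le_mul_of_nonneg_left hdiff (show 0 ≤ 2 * σ by positivity)
    linarith

end Deterministic

/-! ### Passing to remainders with an absolute constant. -/

section AbsoluteConstants

lemma vAlpha_nonneg (m n : ℕ) {α : ℝ} (hα : 0 < α) (hα1 : α ≤ 1) : 0 ≤ vAlpha m n α := by
  have h := log_window_add_four_le m n hα hα1
  have h1 : 0 ≤ Real.log ((m : ℝ) + n + 1) := Real.log_nonneg (by
    have : (0 : ℝ) ≤ m := Nat.cast_nonneg m
    have : (0 : ℝ) ≤ n := Nat.cast_nonneg n
    linarith)
  rw [vAlpha]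
  exact mul_nonneg (by positivity) (by linarith)

lemma log_two_div_nonneg {α : ℝ} (hα : 0 < α) (hα1 : α ≤ 1) :
    Real.log 2 ≤ Real.log (2 / α) := by
  refine Real.log_le_log (by norm_num) ?_
  rw [le_div_iff₀ hα]
  linarith

lemma log_two_div_le {m n : ℕ} {α : ℝ} (hα : 0 < α) (hm : 1 ≤ m) (hn : 1 ≤ n) :
    Real.log (2 / α) ≤ Real.log (((m : ℝ) + n) / α) := by
  have hm' : (1 : ℝ) ≤ m := by exact_mod_cast hm
  have hn' : (1 : ℝ) ≤ n := by exact_mod_cast hn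
  refine Real.log_le_log (by positivity) ?_
  gcongr
  linarith

/-- The remainder with explicit constants is bounded by the remainder `r0Uniform`. -/
lemma explicit_remainder_le {m n s : ℕ} {ρ ϰ α : ℝ} (hm : 1 ≤ m) (hn : 1 ≤ n) (hρ : 1 ≤ ρ)
    (hϰ : 0 ≤ ϰ) (hα : 0 < α) (hα1 : α ≤ 1) :
    Real.sqrt (ρ * vAlpha m n α) + Real.sqrt ((ρ + 1) * cAlpha α * ϰ) + Real.sqrt (2 * s)
      + cAlpha α ≤ 50 * Real.sqrt (r0Uniform m n s ρ ϰ α) := by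
  have hm' : (1 : ℝ) ≤ m := by exact_mod_cast hm
  have hn' : (1 : ℝ) ≤ n := by exact_mod_cast hn
  set ℓ := Real.log (((m : ℝ) + n) / α) with hℓ
  set q := Real.log (2 / α) with hq
  set κ := kappa m n with hκ
  have hq2 : Real.log 2 ≤ q := log_two_div_nonneg hα hα1
  have hqℓ : q ≤ ℓ := log_two_div_le hα hm hn
  have hlog2 : 0 < Real.log 2 := Real.log_pos (by norm_num)
  have hq0 : 0 ≤ q := by linarith
  have hℓ0 : 0 ≤ ℓ := by linarith
  have hs0 : (0 : ℝ) ≤ s := Nat.cast_nonneg s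
  set A := ρ * (1 + κ ^ 2) * ℓ with hA
  set D := ρ * ϰ * Real.sqrt q with hD
  have hA0 : 0 ≤ A := by positivity
  have hD0 : 0 ≤ D := by positivity
  have hr : r0Uniform m n s ρ ϰ α = A + D + s := rfl
  set r := r0Uniform m n s ρ ϰ α
  have hr0 : 0 ≤ r := by rw [hr]; positivity
  -- As m + n ≥ 2, one has 55(m+n+1) ≤ 2⁷(m+n); then 7 log 2 ≤ 7ℓ because ℓ ≥ log(2/α) ≥ log 2.
  have hL : Real.log (55 * ((m : ℝ) + n + 1) / α) ≤ 8 * ℓ := by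
    have h1 : Real.log (55 * ((m : ℝ) + n + 1) / α) ≤ Real.log (2 ^ 7 * (((m : ℝ) + n) / α)) := by
      refine Real.log_le_log (by positivity) ?_
      rw [← mul_div_assoc]
      gcongr ?_ / α
      linarith
    rw [Real.log_mul (by norm_num) (by positivity), Real.log_pow] at h1
    push_cast at h1
    linarith
  -- The constant is 2·32·8 = 512 ≤ 23².
  have hV : ρ * vAlpha m n α ≤ 23 ^ 2 * r := by
    have h1 : (1 + 4 * κ) ^ 2 ≤ 32 * (1 + κ ^ 2) := by nlinarith [sq_nonneg (κ - 4 / 16)]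
    have h2 : vAlpha m n α ≤ 2 * (32 * (1 + κ ^ 2)) * (8 * ℓ) := by
      rw [vAlpha]
      have h3 : 0 ≤ Real.log (55 * ((m : ℝ) + n + 1) / α) := Real.log_nonneg (by
        rw [le_div_iff₀ hα]; linarith)
      exact mul_le_mul (mul_le_mul_of_nonneg_left h1 (by norm_num)) hL h3 (by positivity)
    calc ρ * vAlpha m n α ≤ ρ * (2 * (32 * (1 + κ ^ 2)) * (8 * ℓ)) :=
          mul_le_mul_of_nonneg_left h2 (by linarith)
      _ = 512 * A := by rw [hA]; ring
      _ ≤ 23 ^ 2 * r := by rw [hr]; linarith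
  have hcsq : cAlpha α ^ 2 ≤ 8 * q := by
    rw [cAlpha_sq hα hα1, show (16 : ℝ) / α = 2 ^ 3 * (2 / α) by ring,
      Real.log_mul (by norm_num) (by positivity), Real.log_pow]
    push_cast
    linarith
  have hc0 := cAlpha_nonneg α
  have hc : cAlpha α ≤ 3 * Real.sqrt q := by
    refine (abs_le_of_sq_le_sq' ?_ (by positivity)).2
    rw [mul_pow, Real.sq_sqrt hq0]
    linarith
  have hϰ' : (ρ + 1) * cAlpha α * ϰ ≤ 3 ^ 2 * r := by
    calc (ρ + 1) * cAlpha α * ϰ ≤ (2 * ρ) * (3 * Real.sqrt q) * ϰ := by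
          gcongr
          linarith
      _ = 6 * D := by rw [hD]; ring
      _ ≤ 3 ^ 2 * r := by rw [hr]; linarith
  have hs : 2 * (s : ℝ) ≤ 2 ^ 2 * r := by rw [hr]; linarith
  have hcr : cAlpha α ^ 2 ≤ 3 ^ 2 * r := by
    have h1 : ℓ ≤ A := by
      rw [hA]
      have : 1 ≤ ρ * (1 + κ ^ 2) := by nlinarith [sq_nonneg κ]
      nlinarith
    rw [hr]
    linarith
  have hsqrt : ∀ (c y : ℝ), 0 ≤ c → y ≤ c ^ 2 * r → Real.sqrt y ≤ c * Real.sqrt r := by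
    intro c y hc hy
    refine (Real.sqrt_le_sqrt hy).trans (le_of_eq ?_)
    rw [Real.sqrt_mul (by positivity), Real.sqrt_sq hc]
  have e1 := hsqrt 23 _ (by norm_num) hV
  have e2 := hsqrt 3 _ (by norm_num) hϰ'
  have e3 := hsqrt 2 _ (by norm_num) hs
  have e4 := hsqrt 3 _ (by norm_num) hcr
  rw [Real.sqrt_sq hc0] at e4
  -- The four constants add up to 23 + 3 + 2 + 3 = 31 ≤ 50.
  linarith [Real.sqrt_nonneg r]

/-- For bandwidths at most `n` and levels at most `1 / 2`, the two remainders are equivalent. -/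
lemma r0Uniform_le {m n s : ℕ} {ρ ϰ α : ℝ} (hm : 1 ≤ m) (hmn : m ≤ n) (hρ : 1 ≤ ρ)
    (hϰ : 0 ≤ ϰ) (hα : 0 < α) (hα2 : α ≤ 1 / 2) :
    r0Uniform m n s ρ ϰ α ≤ 2 ^ 2 * r0 m n s ρ ϰ α := by
  have hκ : 1 ≤ kappa m n ^ 2 := by
    rw [kappa_sq, le_div_iff₀ (by positivity)]
    have : (m : ℝ) ≤ n := by exact_mod_cast hmn
    linarith
  have hℓ : 0 ≤ Real.log (((m : ℝ) + n) / α) :=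
    (Real.log_nonneg one_le_two).trans ((log_two_div_nonneg hα (by linarith)).trans
      (log_two_div_le hα hm (hm.trans hmn)))
  have hlog : Real.log (2 / α) ≤ 2 ^ 2 * Real.log (1 / α) := by
    have h1 : Real.log 2 ≤ Real.log (1 / α) := by
      refine Real.log_le_log (by norm_num) ?_
      rw [le_div_iff₀ hα]
      linarith
    have h0 : 0 ≤ Real.log 2 := Real.log_nonneg one_le_two
    rw [show (2 : ℝ) / α = 2 * (1 / α) by ring, Real.log_mul (by norm_num) (by positivity)]
    linarith
  have hsq : Real.sqrt (Real.log (2 / α)) ≤ 2 * Real.sqrt (Real.log (1 / α)) := by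
    refine (Real.sqrt_le_sqrt hlog).trans (le_of_eq ?_)
    rw [Real.sqrt_mul (by positivity), Real.sqrt_sq (by norm_num)]
  have hs0 : (0 : ℝ) ≤ s := Nat.cast_nonneg s
  have h1 : ρ * (1 + kappa m n ^ 2) * Real.log (((m : ℝ) + n) / α)
      ≤ 4 * (ρ * kappa m n ^ 2 * Real.log (((m : ℝ) + n) / α)) := by
    have : 0 ≤ ρ * Real.log (((m : ℝ) + n) / α) := by positivity
    nlinarith
  have h2 : ρ * ϰ * Real.sqrt (Real.log (2 / α))
      ≤ 4 * (ρ * ϰ * Real.sqrt (Real.log (1 / α))) := by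
    have : 0 ≤ ρ * ϰ := by positivity
    nlinarith [mul_le_mul_of_nonneg_left hsq this,
      mul_nonneg this (Real.sqrt_nonneg (Real.log (1 / α)))]
  rw [r0Uniform, r0]
  linarith

end AbsoluteConstants

lemma measurable_windowVec (m n : ℕ) : Measurable (windowVec m n) :=
  (WithLp.measurable_toLp 2 _).comp (measurable_pi_lambda _ fun t => measurable_pi_apply (t : ℤ))

end FilterLS

end

theorem theorem1 : ∃ C : ℝ, 0 < C ∧
    ∀ {Ω : Type*} [MeasurableSpace Ω] (μ : Measure Ω) [IsProbabilityMeasure μ]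
      (m n s : ℕ) (ρ σ ϰ α : ℝ) (x φ : ℤ → ℂ) (ζ : ℤ → Ω → ℂ),
      1 ≤ ρ → 0 ≤ σ → 0 ≤ ϰ → 0 < α → α ≤ 1 →
      FilterLS.IsComplexWhiteNoise μ (Set.Icc (-(m : ℤ)) n) ζ →
      FilterLS.NearShiftInvariant m n s σ ϰ x →
      φ ∈ FilterLS.feasible m ρ →
      ∃ Ξ : Set (ℤ → ℂ), MeasurableSet Ξ ∧
        ENNReal.ofReal (1 - α) ≤ μ {ω | (fun t => ζ t ω) ∈ Ξ} ∧
        ∀ z ∈ Ξ, ∀ φhat : ℤ → ℂ,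
          FilterLS.IsConstrainedLS m n ρ (FilterLS.observe x σ z) φhat →
          -- the bound with explicit constants
          (FilterLS.l2norm n (x - FilterLS.conv φhat (FilterLS.observe x σ z)) ≤
            FilterLS.l2norm n (x - FilterLS.conv φ (FilterLS.observe x σ z)) +
              2 * σ * (Real.sqrt (ρ * FilterLS.vAlpha m n α)
                + Real.sqrt ((ρ + 1) * FilterLS.cAlpha α * ϰ)
                + Real.sqrt (2 * s) + FilterLS.cAlpha α)) ∧
          -- the bound with an absolute constant, uniform in all bandwidths and levels
          (1 ≤ m → 1 ≤ n →
            FilterLS.l2norm n (x - FilterLS.conv φhat (FilterLS.observe x σ z)) ≤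
              FilterLS.l2norm n (x - FilterLS.conv φ (FilterLS.observe x σ z)) +
                C * σ * Real.sqrt (FilterLS.r0Uniform m n s ρ ϰ α)) ∧
          -- its simplified form for bandwidths at most `n` and levels at most `1/2`
          (1 ≤ m → m ≤ n → α ≤ 1 / 2 →
            FilterLS.l2norm n (x - FilterLS.conv φhat (FilterLS.observe x σ z)) ≤
              FilterLS.l2norm n (x - FilterLS.conv φ (FilterLS.observe x σ z)) +
                C * σ * Real.sqrt (FilterLS.r0 m n s ρ ϰ α)) := by
  -- 2·50 = 100 serves the uniform remainder; another factor 2 = √4 comes from `r0Uniform_le`.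
  refine ⟨200, by norm_num, ?_⟩
  intro Ω _ μ _ m n s ρ σ ϰ α x φ ζ hρ hσ hϰ hα hα1 hζ hx hφ
  obtain ⟨hs, -, S, hdim, hS, xS, hxS, ε, hxe, hε⟩ := hx
  -- `finrank` is 0 in infinite dimension, so `1 ≤ s` forces `S` to be finite-dimensional.
  have hfin : Module.Finite ℂ S := Module.finite_of_finrank_pos (by omega)
  have hW : Module.finrank ℂ (S.map (FilterLS.restr m n)) ≤ s :=
    hdim ▸ Submodule.finrank_map_le (FilterLS.restr m n) S
  have hG := FilterLS.measurableSet_noiseEvent s (σ * ϰ) α (S.map (FilterLS.restr m n)) ε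
  -- The event depends on the decomposition of the signal, but on neither `φ` nor `φhat`.
  refine ⟨FilterLS.windowVec m n ⁻¹'
    FilterLS.noiseEvent m n s (σ * ϰ) α (S.map (FilterLS.restr m n)) ε,
    FilterLS.measurable_windowVec m n hG, ?_, ?_⟩
  · have hlaw := hζ.map_eq_stdGaussian
    have h1 := FilterLS.stdGaussian_noiseEvent_ge hs (mul_nonneg hσ hϰ) hα hα1
      (S.map (FilterLS.restr m n)) hW hε
    have hmeas : Measurable fun ω =>
        (WithLp.toLp 2 fun t : Set.Icc (-(m : ℤ)) (n : ℤ) => ζ t ω : FilterLS.WindowSpace m n) :=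
      (WithLp.measurable_toLp 2 _).comp (measurable_pi_lambda _ fun t => hζ.measurable t t.2)
    rw [← hlaw, Measure.map_apply hmeas hG] at h1
    exact h1
  · intro z hz φhat hhat
    have h1 := FilterLS.l2norm_sub_conv_le hρ hσ hϰ (FilterLS.vAlpha_nonneg m n hα hα1) hS hxS hxe
      hz hφ hhat
    have h2 : 1 ≤ m → 1 ≤ n →
        FilterLS.l2norm n (x - FilterLS.conv φhat (FilterLS.observe x σ z)) ≤
          FilterLS.l2norm n (x - FilterLS.conv φ (FilterLS.observe x σ z)) +
            100 * σ * Real.sqrt (FilterLS.r0Uniform m n s ρ ϰ α) := by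
      intro hm hn
      have h3 := mul_le_mul_of_nonneg_left
        (FilterLS.explicit_remainder_le (s := s) hm hn hρ hϰ hα hα1)
        (show 0 ≤ 2 * σ by positivity)
      linarith
    refine ⟨h1, fun hm hn => (h2 hm hn).trans ?_, fun hm hmn hα2 =>
      (h2 hm (hm.trans hmn)).trans ?_⟩
    · gcongr
      norm_num
    · have h3 := Real.sqrt_le_sqrt (FilterLS.r0Uniform_le (s := s) hm hmn hρ hϰ hα hα2)
      rw [Real.sqrt_mul (by positivity), Real.sqrt_sq (by norm_num)] at h3
      have h4 := mul_le_mul_of_nonneg_left h3 (show 0 ≤ 100 * σ by positivity)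
      linarith
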